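/- Let $N\ge 0$, $d_1,\dots,d_N\ge 1$ and $m\ge 0$ be integers. Let $\mathcal H=\mathcal H_1\times\cdots\times\mathcal H_N$ with $\mathcal H_i=\{h_i\in\mathbb R^{d_i}: h_i\ge 0,\ \mathbf 1^\top h_i=1\}$, let $\psi(h)=\sum_{i,j}\big(h_{i,j}\ln h_{i,j}-h_{i,j}\big)$, and let $\eta>0$. Norms are Euclidean for vectors and spectral for matrices. Let $f(h,y)$ and $g(h,y)$ be real functions of $h\in\mathbb R^{d_1+\cdots+d_N}$ and $y\in\mathbb R^m$, and suppose that the derivatives named below exist at the points of $\mathcal H\times\mathbb R^m$ (in particular $g(\cdot,y)$ is differentiable near each point of $\mathcal H$). Assume: (i) on $\mathcal H\times\mathbb R^m$ the gradient of $f$ in $z=(h,y)$ is $L_f$-Lipschitz and bounded in norm by $\Omega_f$; (ii) for every $y$, $g(\cdot,y)$ is convex on $\mathcal H$, and on $\mathcal H$ the gradient $\nabla_h g(\cdot,y)$ is $L_g$-Lipschitz with $\|\nabla_h g\|\le\Omega_g$, the derivatives $\nabla_y\nabla_h g(\cdot,y)$ and $\nabla_h^2 g(\cdot,y)$ are $\tau_g^h$-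 and $\rho_g^h$-Lipschitz, $\|\nabla_h^2 g\|\le L_g$ and $\|\nabla_y\nabla_h g\|\le\Lambda_g^{yh}$; (iii) for every $h\in\mathcal H$, $\nabla_y\nabla_h g(h,\cdot)$ and $\nabla_h^2 g(h,\cdot)$ are $\tau_g^y$- and $\rho_g^y$-Lipschitz on $\mathbb R^m$. Put $g^\eta(h,y)=g(h,y)+\eta\,\psi(h)$, let $h^*(y)$ be the minimizer of $g^\eta(\cdot,y)$ over $\mathcal H$, let $F(y)=f(h^*(y),y)$, and assume that $F$ is bounded below on $\mathbb R^m$. Let $\nu^{\min}=e^{-2\Omega_g/\eta}/\max_i d_i$ and let $\widetilde{\mathcal H}$ be the set of $h\in\mathcal H$ with all coordinates at least $\nu^{\min}$. Algorithm, with step sizes $\alpha,\beta$ and $D$ inner iterations, started at $h^0\in\widetilde{\mathcal H}$ and $y^0\in\mathbb R^m$: for $k=0,1,\dots$ set $h^{0,0}=h^0$, $h^{k,0}=h^{k-1,D}$ for $k>0$, and $R_{k,0}=0$; for $t=0,\dots,D-1$ put $$h^{k,t+1}=T(h^{k,t},y^k),\qquad R_{k,t+1}=\partial_h T(h^{k,t},y^k)\,R_{k,t}+\partial_y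 T(h^{k,t},y^k),$$ where $T$ is the multiplicative-weights step $$T_i(h,y)=\frac{h_i\circ\exp\big(-\alpha\nabla_{h_i}g^\eta(h,y)\big)}{h_i^\top\exp\big(-\alpha\nabla_{h_i}g^\eta(h,y)\big)},\qquad i=1,\dots,N;$$ then put $y^{k+1}=y^k-\beta\big(\nabla_y f(h^{k,D},y^k)+R_{k,D}^\top\nabla_h f(h^{k,D},y^k)\big)$. Then for every $y$ the minimizer $h^*(y)$ exists and is unique, $F$ is differentiable, and there are constants $\overline\alpha>0$ and $0<\underline\beta<\overline\beta$ such that for every $\alpha\in(0,\overline\alpha]$ there are $D^0\in\mathbb N$ and $\lambda\in(0,1)$, a constant $C_2$, and for every $y^0$ a constant $C_1$, such that for all $\beta\in[\underline\beta,\overline\beta]$, $D\ge D^0$, $h^0\in\widetilde{\mathcal H}$ and $K\ge 1$ $$\frac1K\sum_{k=0}^{K-1}\|\nabla F(y^k)\|^2\le\frac{C_1}{K}+C_2\,\lambda^D .$$ -/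

import Mathlib

open scoped Topology

noncomputable section

namespace Bilevel

/-- Lower-level vectors `h = (h_i, i ∈ [N])`, with `h_i ∈ ℝ^{d_i}`, under the Euclidean norm. -/
abbrev LowerVec {N : ℕ} (d : Fin N → ℕ) : Type :=
  EuclideanSpace ℝ (Σ i : Fin N, Fin (d i))

/-- Upper-level vectors `y ∈ ℝ^m`, under the Euclidean norm. -/
abbrev UpperVec (m : ℕ) : Type := EuclideanSpace ℝ (Fin m)

section

variable {N : ℕ} {d : Fin N → ℕ} {m : ℕ}

/-- The product of simplices `H = H_1 × ⋯ × H_N`. -/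
def simplexProd (d : Fin N → ℕ) : Set (LowerVec d) :=
  {h | (∀ p, 0 ≤ h p) ∧ ∀ i : Fin N, ∑ j : Fin (d i), h ⟨i, j⟩ = 1}

/-- `ν^min = exp (-2 Ω_g / η) / max_i d_i`. -/
def nuMin (d : Fin N → ℕ) (η Ωg : ℝ) : ℝ :=
  Real.exp (-(2 * Ωg / η)) / ((Finset.univ.sup d : ℕ) : ℝ)

/-- The truncated simplices: the points of the product of simplices all of whose coordinates
are at least `ν^min`. -/
def truncSimplexProd (d : Fin N → ℕ) (η Ωg : ℝ) : Set (LowerVec d) :=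
  {h | (∀ p, nuMin d η Ωg ≤ h p) ∧ ∀ i : Fin N, ∑ j : Fin (d i), h ⟨i, j⟩ = 1}

/-- The negative Shannon entropy `∑ i, ∑ j, (h_ij ln h_ij - h_ij)`. -/
def negEntropy (h : LowerVec d) : ℝ :=
  ∑ i : Fin N, ∑ j : Fin (d i), (h ⟨i, j⟩ * Real.log (h ⟨i, j⟩) - h ⟨i, j⟩)

/-- The regularized lower-level objective `g^η(h, y) = g(h, y) + η ψ(h)`. -/
def regObj (g : LowerVec d → UpperVec m → ℝ) (η : ℝ) (h : LowerVec d) (y : UpperVec m) : ℝ :=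
  g h y + η * negEntropy h

/-- `h` solves the lower-level problem at `y`. -/
def IsLowerSolution (g : LowerVec d → UpperVec m → ℝ) (η : ℝ) (y : UpperVec m)
    (h : LowerVec d) : Prop :=
  h ∈ simplexProd d ∧ IsMinOn (fun h' => regObj g η h' y) (simplexProd d) h

/-- The lower-level solution `h^*(y)`. -/
def lowerSolution (g : LowerVec d → UpperVec m → ℝ) (η : ℝ) (y : UpperVec m) : LowerVec d :=
  Classical.epsilon (IsLowerSolution g η y)

/-- The bilevel objective `F(y) = f(h^*(y), y)`. -/
def bilevelObj (f g : LowerVec d → UpperVec m → ℝ) (η : ℝ) (y : UpperVec m) : ℝ :=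
  f (lowerSolution g η y) y

/-- The partial gradient `∇_h q(h, y)`. -/
def gradLower (q : LowerVec d → UpperVec m → ℝ) (h : LowerVec d) (y : UpperVec m) : LowerVec d :=
  gradient (fun h' => q h' y) h

/-- The partial gradient `∇_y q(h, y)`. -/
def gradUpper (q : LowerVec d → UpperVec m → ℝ) (h : LowerVec d) (y : UpperVec m) : UpperVec m :=
  gradient (fun y' => q h y') y

/-- A function of `(h, y)` as a function of `z = (h, y)` in the Euclidean product space. -/
def joint (q : LowerVec d → UpperVec m → ℝ) (z : WithLp 2 (LowerVec d × UpperVec m)) : ℝ :=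
  q z.fst z.snd

/-- The Hessian `∇_h² g(h, y)`, as an operator (its operator norm is the spectral norm). -/
def hessLower (g : LowerVec d → UpperVec m → ℝ) (h : LowerVec d) (y : UpperVec m) :
    LowerVec d →L[ℝ] LowerVec d :=
  fderiv ℝ (fun h' => gradLower g h' y) h

/-- The cross derivative `∇_y ∇_h g(h, y)`, as an operator. -/
def crossDeriv (g : LowerVec d → UpperVec m → ℝ) (h : LowerVec d) (y : UpperVec m) :
    UpperVec m →L[ℝ] LowerVec d :=
  fderiv ℝ (fun y' => gradLower g h y') y

/-- Assumptions on the upper-level objective `f`: its gradient in `z = (h, y)` exists, is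
`Lf`-Lipschitz, and is bounded by `Ωf`, on the product of simplices times `ℝ^m`. -/
structure UpperAssumptions (f : LowerVec d → UpperVec m → ℝ) (Lf Ωf : ℝ) : Prop where
  differentiable : ∀ h ∈ simplexProd d, ∀ y : UpperVec m,
    DifferentiableAt ℝ (joint f) (WithLp.toLp 2 (h, y))
  lipschitz_grad : ∀ h ∈ simplexProd d, ∀ h' ∈ simplexProd d, ∀ y y' : UpperVec m,
    ‖gradient (joint f) (WithLp.toLp 2 (h, y)) - gradient (joint f) (WithLp.toLp 2 (h', y'))‖
      ≤ Lf * ‖WithLp.toLp 2 (h, y) - WithLp.toLp 2 (h', y')‖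
  bounded_grad : ∀ h ∈ simplexProd d, ∀ y : UpperVec m,
    ‖gradient (joint f) (WithLp.toLp 2 (h, y))‖ ≤ Ωf

/-- Assumptions on the lower-level objective `g`: convexity in `h` on the product of simplices,
existence there of the derivatives that occur, and their Lipschitz and boundedness properties. -/
structure LowerAssumptions (g : LowerVec d → UpperVec m → ℝ)
    (Lg Ωg τh ρh Λ τy ρy : ℝ) : Prop where
  convex : ∀ y : UpperVec m, ConvexOn ℝ (simplexProd d) (fun h => g h y)
  differentiable : ∀ h ∈ simplexProd d, ∀ y : UpperVec m,
    ∀ᶠ h' in 𝓝 h, DifferentiableAt ℝ (fun h'' => g h'' y) h'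
  differentiable_grad_lower : ∀ h ∈ simplexProd d, ∀ y : UpperVec m,
    DifferentiableAt ℝ (fun h' => gradLower g h' y) h
  differentiable_grad_upper : ∀ h ∈ simplexProd d, ∀ y : UpperVec m,
    DifferentiableAt ℝ (fun y' => gradLower g h y') y
  lipschitz_grad : ∀ y : UpperVec m, ∀ h ∈ simplexProd d, ∀ h' ∈ simplexProd d,
    ‖gradLower g h y - gradLower g h' y‖ ≤ Lg * ‖h - h'‖
  bounded_grad : ∀ y : UpperVec m, ∀ h ∈ simplexProd d, ‖gradLower g h y‖ ≤ Ωg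
  lipschitz_cross_lower : ∀ y : UpperVec m, ∀ h ∈ simplexProd d, ∀ h' ∈ simplexProd d,
    ‖crossDeriv g h y - crossDeriv g h' y‖ ≤ τh * ‖h - h'‖
  lipschitz_hess_lower : ∀ y : UpperVec m, ∀ h ∈ simplexProd d, ∀ h' ∈ simplexProd d,
    ‖hessLower g h y - hessLower g h' y‖ ≤ ρh * ‖h - h'‖
  bounded_hess : ∀ y : UpperVec m, ∀ h ∈ simplexProd d, ‖hessLower g h y‖ ≤ Lg
  bounded_cross : ∀ y : UpperVec m, ∀ h ∈ simplexProd d, ‖crossDeriv g h y‖ ≤ Λ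
  lipschitz_cross_upper : ∀ h ∈ simplexProd d, ∀ y y' : UpperVec m,
    ‖crossDeriv g h y - crossDeriv g h y'‖ ≤ τy * ‖y - y'‖
  lipschitz_hess_upper : ∀ h ∈ simplexProd d, ∀ y y' : UpperVec m,
    ‖hessLower g h y - hessLower g h y'‖ ≤ ρy * ‖y - y'‖

/-- One step of mirror descent (multiplicative weights) on the lower level,
`h_i ↦ h_i ∘ exp (-α ∇_{h_i} g^η) / (h_iᵀ exp (-α ∇_{h_i} g^η))` for each `i`. -/
def mirrorStep (g : LowerVec d → UpperVec m → ℝ) (η α : ℝ) (h : LowerVec d) (y : UpperVec m) :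
    LowerVec d :=
  WithLp.toLp 2 fun p : (Σ i : Fin N, Fin (d i)) =>
    h p * Real.exp (-α * gradLower (regObj g η) h y p) /
      ∑ j : Fin (d p.1), h ⟨p.1, j⟩ * Real.exp (-α * gradLower (regObj g η) h y ⟨p.1, j⟩)

/-- One step of iterative differentiation: the derivative in `y` of the mirror descent step
`mirrorStep g η α h y`, where the current iterate `h` depends on `y` with Jacobian `R`. -/
def jacobianStep (g : LowerVec d → UpperVec m → ℝ) (η α : ℝ)
    (R : UpperVec m →L[ℝ] LowerVec d) (h : LowerVec d) (y : UpperVec m) :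
    UpperVec m →L[ℝ] LowerVec d :=
  (fderiv ℝ (fun h' => mirrorStep g η α h' y) h).comp R +
    fderiv ℝ (fun y' => mirrorStep g η α h y') y

/-- The lower-level iterates `h^{k,t}`, started at `h^{k,0} = h` with `y^k = y`. -/
def lowerIter (g : LowerVec d → UpperVec m → ℝ) (η α : ℝ) (h : LowerVec d) (y : UpperVec m) :
    ℕ → LowerVec d
  | 0 => h
  | t + 1 => mirrorStep g η α (lowerIter g η α h y t) y

/-- The Jacobian iterates `R_{k,t}`, started at `R_{k,0} = 0`. -/
def jacobianIter (g : LowerVec d → UpperVec m → ℝ) (η α : ℝ) (h : LowerVec d) (y : UpperVec m) :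
    ℕ → (UpperVec m →L[ℝ] LowerVec d)
  | 0 => 0
  | t + 1 => jacobianStep g η α (jacobianIter g η α h y t) (lowerIter g η α h y t) y

/-- The gradient estimator `∇_y f(h^{k,D}, y^k) + R_{k,D}ᵀ ∇_h f(h^{k,D}, y^k)`. -/
def gradEstimate (f g : LowerVec d → UpperVec m → ℝ) (η α : ℝ) (D : ℕ)
    (h : LowerVec d) (y : UpperVec m) : UpperVec m :=
  gradUpper f (lowerIter g η α h y D) y +
    ContinuousLinearMap.adjoint (jacobianIter g η α h y D)
      (gradLower f (lowerIter g η α h y D) y)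

/-- The double-loop algorithm with constant step sizes `α`, `β` and no upper-level constraint:
the `k`-th value is the pair `(h^{k,0}, y^k)`, with warm start `h^{k+1,0} = h^{k,D}`. -/
def algorithm (f g : LowerVec d → UpperVec m → ℝ) (η α β : ℝ) (D : ℕ)
    (h0 : LowerVec d) (y0 : UpperVec m) : ℕ → LowerVec d × UpperVec m
  | 0 => (h0, y0)
  | k + 1 =>
    let s := algorithm f g η α β D h0 y0 k
    (lowerIter g η α s.1 s.2 D, s.2 - β • gradEstimate f g η α D s.1 s.2)

/-- The upper-level iterates `y^k`. -/
def upperIter (f g : LowerVec d → UpperVec m → ℝ) (η α β : ℝ) (D : ℕ)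
    (h0 : LowerVec d) (y0 : UpperVec m) (k : ℕ) : UpperVec m :=
  (algorithm f g η α β D h0 y0 k).2

end

end Bilevel

end

/-!
The lower level is solved by mirror descent with the entropy, and everything rests on two facts
about the step `T`.

* *Linear convergence in the Bregman divergence.* `g^η` is `η`-strongly convex and smooth relative
  to the entropy, so `D(u, T h) ≤ (1 - α η) D(u, h) + α (g^η(u) - g^η(T h))` for every `u` in the
  product of simplices (`RegularLower.bregman_mirrorStep_le`). The truncated simplices are
  invariant under `T` (`RegularLower.mirrorStep_mem_trunc`). Hence any minimizer `u` is the limit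
  of the iterates from a point of the truncated simplices. This gives uniqueness, the lower bound
  `ν^min` on the coordinates of `h^*(y)`, and `T h^* = h^*`, which is the optimality condition
  that `∇_h g^η` is orthogonal to the tangent space (`RegularLower.inner_grad_lowerSolution`). The
  rate is uniform in `y` and in the starting point.
* *Contraction of the Jacobian recursion.* At `x = h^*(y)` the derivative of `T` on the tangent
  space is `(1 - α η) - α (diag x - x xᵀ) ∇_h² g`. It is self-adjoint for the inner product
  `⟪v, w / x⟫`, with spectrum in `[0, 1 - α η]` (`RegularLower.norm_softmaxJac_logStepDeriv_le`). Away
  from `x` the recursion is a perturbation of size `O(‖h^t - x‖)`, which is geometrically small,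
  so `R_t` converges geometrically to its fixed point (`RegularLower.exists_linear_convergence`).

The fixed point is the derivative of `h^*`. Linearizing the optimality condition with quadratic
remainders, and using that the Hessian of `g^η` is coercive on the tangent space, shows that `h^*`
is differentiable with a bounded Lipschitz derivative (`RegularLower.hasFDerivAt_lowerSolution`,
`RegularLower.exists_lipschitz_implicitDeriv`). Therefore `∇F` is Lipschitz, and the gradient
estimator differs from `∇F(y^k)` by at most `C λ^D`, whatever the warm start
(`RegularLower.exists_gradEstimate_error`). The algorithm is thus gradient descent on `F` with
errors bounded by `C λ^D`, and summing the descent inequality gives the claim with `D^0 = 0`.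
-/

noncomputable section

namespace Bilevel

section

variable {N : ℕ} {d : Fin N → ℕ} {m : ℕ}

/-! ### Blockwise linear algebra -/

/-- The diagonal operator `v ↦ c ∘ v`. -/
def diagOp (c : (Σ i : Fin N, Fin (d i)) → ℝ) : LowerVec d →L[ℝ] LowerVec d :=
  LinearMap.toContinuousLinearMap
    { toFun := fun v => WithLp.toLp 2 fun p => c p * v p
      map_add' := fun v w => by ext p; simp [mul_add]
      map_smul' := fun a v => by ext p; simp [mul_left_comm] }

@[simp]
lemma diagOp_apply (c : (Σ i : Fin N, Fin (d i)) → ℝ) (v : LowerVec d)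
    (p : Σ i : Fin N, Fin (d i)) : diagOp c v p = c p * v p := rfl

/-- The blockwise matrix `diag x - x xᵀ`. It is the Jacobian of the blockwise softmax map at a
point where the softmax takes the value `x`. -/
def softmaxJac (x : LowerVec d) : LowerVec d →L[ℝ] LowerVec d :=
  LinearMap.toContinuousLinearMap
    { toFun := fun w => WithLp.toLp 2 fun p : (Σ i : Fin N, Fin (d i)) =>
        x p * (w p - ∑ j : Fin (d p.1), x ⟨p.1, j⟩ * w ⟨p.1, j⟩)
      map_add' := fun v w => by
        ext p; simp only [PiLp.add_apply, mul_add, Finset.sum_add_distrib]; ring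
      map_smul' := fun a v => by
        ext p
        simp only [PiLp.smul_apply, smul_eq_mul, mul_left_comm _ a, ← Finset.mul_sum,
          RingHom.id_apply]
        ring }

lemma softmaxJac_apply (x w : LowerVec d) (p : Σ i : Fin N, Fin (d i)) :
    softmaxJac x w p = x p * (w p - ∑ j : Fin (d p.1), x ⟨p.1, j⟩ * w ⟨p.1, j⟩) := rfl

/-- The tangent space of the product of simplices: every block sums to zero. -/
def tangent (d : Fin N → ℕ) : Submodule ℝ (LowerVec d) where
  carrier := {v | ∀ i : Fin N, ∑ j : Fin (d i), v ⟨i, j⟩ = 0}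
  add_mem' := fun {v w} hv hw i => by
    simp only [PiLp.add_apply, Finset.sum_add_distrib, hv i, hw i, add_zero]
  zero_mem' := fun i => by simp
  smul_mem' := fun a v hv i => by
    simp only [PiLp.smul_apply, smul_eq_mul, ← Finset.mul_sum, hv i, mul_zero]

lemma inner_eq_sum (v w : LowerVec d) : inner ℝ v w = ∑ p, v p * w p := by
  simp only [PiLp.inner_apply, RCLike.inner_apply, conj_trivial, mul_comm]

lemma norm_sq_eq_sum (v : LowerVec d) : ‖v‖ ^ 2 = ∑ p, v p ^ 2 := by
  simp [EuclideanSpace.norm_sq_eq]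

lemma abs_apply_le_norm (v : LowerVec d) (p : Σ i : Fin N, Fin (d i)) : |v p| ≤ ‖v‖ := by
  simpa using PiLp.norm_apply_le v p

lemma norm_le_card_mul {v : LowerVec d} {c : ℝ} (h : ∀ p, |v p| ≤ c) :
    ‖v‖ ≤ (Fintype.card (Σ i : Fin N, Fin (d i)) : ℝ) * c := by
  have hs : v = ∑ p, EuclideanSpace.single p (v p) := by
    ext q
    simp [Finset.sum_apply, Pi.single_apply]
  calc ‖v‖ = ‖∑ p, EuclideanSpace.single p (v p)‖ := by rw [← hs]
    _ ≤ ∑ p, ‖EuclideanSpace.single p (v p)‖ := norm_sum_le _ _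
    _ ≤ ∑ _p : (Σ i : Fin N, Fin (d i)), c :=
      Finset.sum_le_sum fun p _ => by simpa using h p
    _ = _ := by simp

lemma norm_diagOp_le {c : (Σ i : Fin N, Fin (d i)) → ℝ} {b : ℝ} (hb : 0 ≤ b)
    (h : ∀ p, |c p| ≤ b) : ‖diagOp c‖ ≤ b := by
  refine ContinuousLinearMap.opNorm_le_bound _ hb fun v => ?_
  refine abs_le_of_sq_le_sq' ?_ (by positivity) |>.2
  rw [mul_pow, norm_sq_eq_sum, norm_sq_eq_sum, Finset.mul_sum]
  refine Finset.sum_le_sum fun p _ => ?_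
  rw [diagOp_apply, mul_pow, ← sq_abs (c p)]
  gcongr
  exact h p

lemma inner_diagOp_comm (c : (Σ i : Fin N, Fin (d i)) → ℝ) (v w : LowerVec d) :
    inner ℝ v (diagOp c w) = inner ℝ w (diagOp c v) := by
  simp only [inner_eq_sum, diagOp_apply]
  exact Finset.sum_congr rfl fun p _ => by ring

/-- A block-constant vector is orthogonal to the tangent space. -/
lemma inner_blockConst {v : LowerVec d} (hv : v ∈ tangent d) (c : Fin N → ℝ) :
    ∑ p : (Σ i : Fin N, Fin (d i)), v p * c p.1 = 0 := by
  rw [Fintype.sum_sigma]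
  refine Finset.sum_eq_zero fun i _ => ?_
  dsimp only
  rw [← Finset.sum_mul, hv i, zero_mul]

lemma exists_blockConst_of_orthogonal (hd : ∀ i, 0 < d i) {w : LowerVec d}
    (hw : ∀ v ∈ tangent d, inner ℝ v w = 0) : ∃ c : Fin N → ℝ, ∀ p, w p = c p.1 := by
  refine ⟨fun i => w ⟨i, ⟨0, hd i⟩⟩, fun p => ?_⟩
  have hmem : EuclideanSpace.single p (1 : ℝ) - EuclideanSpace.single ⟨p.1, ⟨0, hd p.1⟩⟩ 1
      ∈ tangent d := by
    intro i
    obtain ⟨i', j'⟩ := p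
    by_cases hi : i = i'
    · subst hi
      simp [Finset.sum_sub_distrib]
    · have : ∀ (j : Fin (d i)) (j' : Fin (d i')), (⟨i, j⟩ : Σ i, Fin (d i)) ≠ ⟨i', j'⟩ := by
        intro j j' h
        exact hi (congrArg Sigma.fst h)
      simp [this]
  have := hw _ hmem
  rw [inner_sub_left, EuclideanSpace.inner_single_left, EuclideanSpace.inner_single_left] at this
  simpa [sub_eq_zero] using this

/-! ### The simplices -/

lemma le_one_of_mem {h : LowerVec d} (hh : h ∈ simplexProd d) (p : Σ i : Fin N, Fin (d i)) :
    h p ≤ 1 := by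
  rw [← hh.2 p.1]
  exact Finset.single_le_sum (f := fun j => h ⟨p.1, j⟩) (fun j _ => hh.1 _) (Finset.mem_univ p.2)

lemma convex_simplexProd : Convex ℝ (simplexProd d) := by
  intro x hx y hy a b ha hb hab
  refine ⟨fun p => ?_, fun i => ?_⟩
  · have := hx.1 p
    have := hy.1 p
    simp only [PiLp.add_apply, PiLp.smul_apply, smul_eq_mul]
    positivity
  · simp only [PiLp.add_apply, PiLp.smul_apply, smul_eq_mul, Finset.sum_add_distrib,
      ← Finset.mul_sum, hx.2 i, hy.2 i, mul_one, hab]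

lemma sub_mem_tangent {x y : LowerVec d} (hx : x ∈ simplexProd d) (hy : y ∈ simplexProd d) :
    x - y ∈ tangent d := fun i => by
  simp only [PiLp.sub_apply, Finset.sum_sub_distrib, hx.2 i, hy.2 i, sub_self]

lemma abs_sum_mul_le {x : LowerVec d} (hx : x ∈ simplexProd d) (w : LowerVec d) (i : Fin N) :
    |∑ j : Fin (d i), x ⟨i, j⟩ * w ⟨i, j⟩| ≤ ‖w‖ := by
  calc |∑ j : Fin (d i), x ⟨i, j⟩ * w ⟨i, j⟩| ≤ ∑ j : Fin (d i), |x ⟨i, j⟩ * w ⟨i, j⟩| :=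
        Finset.abs_sum_le_sum_abs _ _
    _ ≤ ∑ j : Fin (d i), x ⟨i, j⟩ * ‖w‖ := by
        refine Finset.sum_le_sum fun j _ => ?_
        rw [abs_mul, abs_of_nonneg (hx.1 _)]
        exact mul_le_mul_of_nonneg_left (abs_apply_le_norm _ _) (hx.1 _)
    _ = ‖w‖ := by rw [← Finset.sum_mul, hx.2 i, one_mul]

lemma abs_sum_mul_le_norm_mul (x w : LowerVec d) (i : Fin N) :
    |∑ j : Fin (d i), x ⟨i, j⟩ * w ⟨i, j⟩| ≤
      (Fintype.card (Σ i : Fin N, Fin (d i)) : ℝ) * (‖x‖ * ‖w‖) := by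
  calc |∑ j : Fin (d i), x ⟨i, j⟩ * w ⟨i, j⟩| ≤ ∑ j : Fin (d i), |x ⟨i, j⟩ * w ⟨i, j⟩| :=
        Finset.abs_sum_le_sum_abs _ _
    _ ≤ ∑ _j : Fin (d i), ‖x‖ * ‖w‖ := by
        refine Finset.sum_le_sum fun j _ => ?_
        rw [abs_mul]
        exact mul_le_mul (abs_apply_le_norm _ _) (abs_apply_le_norm _ _) (abs_nonneg _)
          (norm_nonneg _)
    _ = (d i : ℝ) * (‖x‖ * ‖w‖) := by simp
    _ ≤ _ := by
        gcongr
        rw [Fintype.card_sigma]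
        simpa using Finset.single_le_sum (f := d) (fun _ _ => Nat.zero_le _) (Finset.mem_univ i)

/-! ### The softmax map and its Jacobian -/

/-- The blockwise softmax map. -/
def softmax (u : LowerVec d) : LowerVec d :=
  WithLp.toLp 2 fun p : (Σ i : Fin N, Fin (d i)) =>
    Real.exp (u p) / ∑ j : Fin (d p.1), Real.exp (u ⟨p.1, j⟩)

lemma softmax_apply (u : LowerVec d) (p : Σ i : Fin N, Fin (d i)) :
    softmax u p = Real.exp (u p) / ∑ j : Fin (d p.1), Real.exp (u ⟨p.1, j⟩) := rfl

lemma sum_exp_pos (u : LowerVec d) (p : Σ i : Fin N, Fin (d i)) :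
    0 < ∑ j : Fin (d p.1), Real.exp (u ⟨p.1, j⟩) :=
  Finset.sum_pos (fun _ _ => Real.exp_pos _) ⟨p.2, Finset.mem_univ _⟩

lemma softmax_pos (u : LowerVec d) (p : Σ i : Fin N, Fin (d i)) : 0 < softmax u p :=
  div_pos (Real.exp_pos _) (sum_exp_pos u p)

lemma softmax_mem (hd : ∀ i, 0 < d i) (u : LowerVec d) : softmax u ∈ simplexProd d := by
  refine ⟨fun p => (softmax_pos u p).le, fun i => ?_⟩
  change ∑ j : Fin (d i), Real.exp (u ⟨i, j⟩) / ∑ l : Fin (d i), Real.exp (u ⟨i, l⟩) = 1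
  rw [← Finset.sum_div, div_self]
  exact (sum_exp_pos u ⟨i, ⟨0, hd i⟩⟩).ne'

lemma log_softmax (u : LowerVec d) (p : Σ i : Fin N, Fin (d i)) :
    Real.log (softmax u p) = u p - Real.log (∑ j : Fin (d p.1), Real.exp (u ⟨p.1, j⟩)) := by
  rw [softmax_apply, Real.log_div (Real.exp_pos _).ne' (sum_exp_pos u p).ne', Real.log_exp]

lemma hasFDerivAt_softmax (u : LowerVec d) :
    HasFDerivAt (softmax (d := d)) (softmaxJac (softmax u)) u := by
  rw [← hasFDerivWithinAt_univ, hasFDerivWithinAt_euclidean]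
  intro p
  rw [hasFDerivWithinAt_univ]
  have h1 : ∀ q : (Σ i : Fin N, Fin (d i)), HasFDerivAt (fun u : LowerVec d => Real.exp (u q))
      (Real.exp (u q) • (EuclideanSpace.proj q : LowerVec d →L[ℝ] ℝ)) u := fun q =>
    ((EuclideanSpace.proj q : LowerVec d →L[ℝ] ℝ).hasFDerivAt).exp
  have h2 := HasFDerivAt.fun_sum (u := Finset.univ) fun (j : Fin (d p.1)) _ => h1 ⟨p.1, j⟩
  have hs := sum_exp_pos u p
  have h3 := (h1 p).fun_mul ((hasDerivAt_inv hs.ne').comp_hasFDerivAt u h2)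
  refine h3.congr_fderiv ?_
  ext w
  have : ∑ j : Fin (d p.1), softmax u ⟨p.1, j⟩ * w ⟨p.1, j⟩ =
      (∑ j : Fin (d p.1), Real.exp (u ⟨p.1, j⟩) * w ⟨p.1, j⟩) /
        ∑ j : Fin (d p.1), Real.exp (u ⟨p.1, j⟩) := by
    rw [Finset.sum_div]
    exact Finset.sum_congr rfl fun j _ => by rw [softmax_apply]; ring
  have e : (PiLp.proj 2 (fun _ => ℝ) p ∘L softmaxJac (softmax u)) w =
      softmax u p * (w p - ∑ j : Fin (d p.1), softmax u ⟨p.1, j⟩ * w ⟨p.1, j⟩) := rfl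
  rw [e, this, softmax_apply]
  simp
  field_simp
  ring

section softmaxJac

variable {x : LowerVec d}

lemma softmaxJac_mem_tangent (hx : x ∈ simplexProd d) (w : LowerVec d) :
    softmaxJac x w ∈ tangent d := fun i => by
  change ∑ j : Fin (d i), x ⟨i, j⟩ * (w ⟨i, j⟩ - ∑ l : Fin (d i), x ⟨i, l⟩ * w ⟨i, l⟩) = 0
  simp only [mul_sub, Finset.sum_sub_distrib, ← Finset.sum_mul, hx.2 i, one_mul, sub_self]

lemma softmaxJac_diagOp_inv (hpos : ∀ p, 0 < x p) {v : LowerVec d} (hv : v ∈ tangent d) :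
    softmaxJac x (diagOp (fun p => (x p)⁻¹) v) = v := by
  ext p
  have : ∑ j : Fin (d p.1), x ⟨p.1, j⟩ * ((x ⟨p.1, j⟩)⁻¹ * v ⟨p.1, j⟩) = 0 := by
    rw [← hv p.1]
    exact Finset.sum_congr rfl fun j _ => mul_inv_cancel_left₀ (hpos _).ne' _
  simp only [softmaxJac_apply, diagOp_apply, this, sub_zero]
  exact mul_inv_cancel_left₀ (hpos _).ne' _

lemma softmaxJac_blockConst (hx : x ∈ simplexProd d) {w : LowerVec d} (c : Fin N → ℝ)
    (hw : ∀ p, w p = c p.1) : softmaxJac x w = 0 := by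
  ext p
  simp [softmaxJac_apply, hw, ← Finset.sum_mul, hx.2]

lemma inner_diagOp_inv_softmaxJac (hpos : ∀ p, 0 < x p) {v : LowerVec d}
    (hv : v ∈ tangent d) (w : LowerVec d) :
    inner ℝ v (diagOp (fun p => (x p)⁻¹) (softmaxJac x w)) = inner ℝ v w := by
  simp only [inner_eq_sum, diagOp_apply, softmaxJac_apply]
  have h1 : ∀ p, v p * ((x p)⁻¹ * (x p * (w p - ∑ j : Fin (d p.1), x ⟨p.1, j⟩ * w ⟨p.1, j⟩))) =
      v p * w p - v p * ∑ j : Fin (d p.1), x ⟨p.1, j⟩ * w ⟨p.1, j⟩ := fun p => by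
    rw [inv_mul_cancel_left₀ (hpos p).ne']; ring
  simp only [h1, Finset.sum_sub_distrib]
  rw [inner_blockConst hv fun i => ∑ j : Fin (d i), x ⟨i, j⟩ * w ⟨i, j⟩, sub_zero]

end softmaxJac

lemma norm_softmaxJac_le {x : LowerVec d} (hx : x ∈ simplexProd d) :
    ‖softmaxJac x‖ ≤ 2 * (Fintype.card (Σ i : Fin N, Fin (d i)) : ℝ) := by
  refine ContinuousLinearMap.opNorm_le_bound _ (by positivity) fun w => ?_
  refine (norm_le_card_mul (c := 2 * ‖w‖) fun p => ?_).trans_eq (by ring)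
  rw [softmaxJac_apply, abs_mul, abs_of_nonneg (hx.1 p)]
  have h1 := abs_sub (w p) (∑ j : Fin (d p.1), x ⟨p.1, j⟩ * w ⟨p.1, j⟩)
  have h2 := abs_apply_le_norm w p
  have h3 := abs_sum_mul_le hx w p.1
  calc _ ≤ 1 * (2 * ‖w‖) := by
        gcongr
        · exact le_one_of_mem hx p
        · linarith
    _ = _ := one_mul _

lemma norm_softmaxJac_sub_le {x x' : LowerVec d} (hx : x ∈ simplexProd d)
    (hx' : x' ∈ simplexProd d) :
    ‖softmaxJac x - softmaxJac x'‖ ≤ ((Fintype.card (Σ i : Fin N, Fin (d i)) : ℝ) *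
      (2 + (Fintype.card (Σ i : Fin N, Fin (d i)) : ℝ))) * ‖x - x'‖ := by
  set n : ℝ := (Fintype.card (Σ i : Fin N, Fin (d i)) : ℝ)
  refine ContinuousLinearMap.opNorm_le_bound _ (by positivity) fun w => ?_
  refine (norm_le_card_mul (c := (2 + n) * (‖x - x'‖ * ‖w‖)) fun p => ?_).trans_eq (by ring)
  have e : (softmaxJac x - softmaxJac x') w p =
      (x - x') p * (w p - ∑ j : Fin (d p.1), x ⟨p.1, j⟩ * w ⟨p.1, j⟩) -
        x' p * ∑ j : Fin (d p.1), (x - x') ⟨p.1, j⟩ * w ⟨p.1, j⟩ := by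
    simp only [_root_.sub_apply, PiLp.sub_apply, softmaxJac_apply, sub_mul,
      Finset.sum_sub_distrib]
    ring
  rw [e]
  refine (abs_sub _ _).trans ?_
  rw [abs_mul, abs_mul, abs_of_nonneg (hx'.1 p)]
  have h1 := abs_sub (w p) (∑ j : Fin (d p.1), x ⟨p.1, j⟩ * w ⟨p.1, j⟩)
  have h2 := abs_apply_le_norm w p
  have h3 := abs_sum_mul_le hx w p.1
  have h4 := abs_sum_mul_le_norm_mul (x - x') w p.1
  calc _ ≤ ‖x - x'‖ * (2 * ‖w‖) + 1 * (n * (‖x - x'‖ * ‖w‖)) := by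
        gcongr
        · exact abs_apply_le_norm _ p
        · linarith
        · exact le_one_of_mem hx' p
    _ = _ := by ring

/-! ### Variational equations on a subspace -/

/-- The Lax–Milgram solution operator: if `M` is coercive on a subspace `V`, then for every `w`
there is a point `R w` of `V` with `M (R w) + C w ⊥ V`, and it depends linearly on `w`. -/
lemma exists_variational_solution {E F : Type*} [NormedAddCommGroup E] [InnerProductSpace ℝ E]
    [FiniteDimensional ℝ E] [NormedAddCommGroup F] [InnerProductSpace ℝ F]
    (V : Submodule ℝ E) (M : E →L[ℝ] E) {η : ℝ} (hη : 0 < η)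
    (hM : ∀ v ∈ V, η * ‖v‖ ^ 2 ≤ inner ℝ v (M v)) (C : F →L[ℝ] E) :
    ∃ R : F →L[ℝ] E, (∀ w, R w ∈ V) ∧ ∀ w, ∀ v ∈ V, inner ℝ v (M (R w) + C w) = 0 := by
  have hinj : Function.Injective
      ((V.orthogonalProjectionOnto ∘L M ∘L V.subtypeL : V →L[ℝ] V) : V →ₗ[ℝ] V) := by
    rw [← LinearMap.ker_eq_bot, LinearMap.ker_eq_bot']
    intro v hv
    have hv' : V.orthogonalProjectionOnto (M v) = 0 := hv
    have h1 := hM v v.2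
    have h2 : inner ℝ (v : E) (M v) = 0 := by
      have := V.inner_orthogonalProjectionOnto_eq_of_mem_left v (M v)
      rw [hv'] at this
      simpa using this.symm
    rw [h2] at h1
    have h3 : ‖(v : E)‖ ^ 2 ≤ 0 := by nlinarith
    have h4 : ‖(v : E)‖ = 0 := by nlinarith [norm_nonneg (v : E)]
    exact Subtype.ext (norm_eq_zero.1 h4)
  let K := LinearEquiv.ofInjectiveEndo _ hinj
  refine ⟨-(V.subtypeL ∘L (LinearMap.toContinuousLinearMap (K.symm : V →ₗ[ℝ] V)) ∘L
    V.orthogonalProjectionOnto ∘L C), fun w => V.neg_mem (Subtype.mem _), fun w v hv => ?_⟩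
  have hK : V.orthogonalProjectionOnto (M (K.symm (V.orthogonalProjectionOnto (C w)) : V)) =
      V.orthogonalProjectionOnto (C w) := K.apply_symm_apply _
  have : V.orthogonalProjectionOnto
      (M (-(K.symm (V.orthogonalProjectionOnto (C w)) : V)) + C w) = 0 := by
    rw [map_add, map_neg, map_neg, hK]; simp
  have h2 := V.inner_orthogonalProjectionOnto_eq_of_mem_left ⟨v, hv⟩
    (M (-(K.symm (V.orthogonalProjectionOnto (C w)) : V)) + C w)
  rw [this] at h2
  simpa using h2.symm

end

/-! ### Convexity and smoothness inequalities -/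

section

variable {E G : Type*} [NormedAddCommGroup E] [NormedAddCommGroup G] [NormedSpace ℝ G]

lemma add_inner_gradient_le [InnerProductSpace ℝ E] [CompleteSpace E] {s : Set E} {f : E → ℝ}
    (hf : ConvexOn ℝ s f) {x y v : E} (hx : x ∈ s) (hy : y ∈ s) (hv : HasGradientAt f v x) :
    f x + inner ℝ v (y - x) ≤ f y := by
  have hc : ConvexOn ℝ (AffineMap.lineMap (k := ℝ) x y ⁻¹' s)
      (f ∘ AffineMap.lineMap (k := ℝ) x y) := hf.comp_affineMap _
  have hd : HasDerivAt (f ∘ AffineMap.lineMap (k := ℝ) x y) (inner ℝ v (y - x)) 0 := by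
    have h1 : HasFDerivAt f (InnerProductSpace.toDual ℝ E v)
        (AffineMap.lineMap (k := ℝ) x y (0 : ℝ)) := by
      simpa using hv.hasFDerivAt
    have h2 : HasDerivAt (AffineMap.lineMap (k := ℝ) x y) (y - x) (0 : ℝ) :=
      AffineMap.hasDerivAt_lineMap
    simpa using h1.comp_hasDerivAt (0 : ℝ) h2
  have := hc.le_slope_of_hasDerivAt (x := 0) (y := 1) (by simpa using hx) (by simpa using hy)
    one_pos hd
  simp [slope_def_field] at this
  linarith

/-- First-order Taylor expansion with quadratic remainder, from a Lipschitz derivative on a convex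
set (the constant is not the sharp `L / 2`). -/
lemma norm_sub_sub_le_of_lipschitz_deriv [NormedSpace ℝ E] {s : Set E} (hs : Convex ℝ s)
    {f : E → G} {f' : E → E →L[ℝ] G} {L : ℝ} (hL : 0 ≤ L)
    (hf : ∀ x ∈ s, HasFDerivAt f (f' x) x)
    (hlip : ∀ x ∈ s, ∀ y ∈ s, ‖f' x - f' y‖ ≤ L * ‖x - y‖) {x y : E} (hx : x ∈ s) (hy : y ∈ s) :
    ‖f y - f x - f' x (y - x)‖ ≤ L * ‖y - x‖ ^ 2 := by
  have hsub : segment ℝ x y ⊆ s := hs.segment_subset hx hy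
  have := (convex_segment x y).norm_image_sub_le_of_norm_hasFDerivWithin_le' (f := f) (f' := f')
    (φ := f' x) (C := L * ‖y - x‖) (fun z hz => (hf z (hsub hz)).hasFDerivWithinAt)
    (fun z hz => (hlip z (hsub hz) x hx).trans
      (mul_le_mul_of_nonneg_left (norm_sub_le_of_mem_segment hz) hL))
    (left_mem_segment ℝ x y) (right_mem_segment ℝ x y)
  rwa [mul_assoc, ← sq] at this

lemma descent_inequality [InnerProductSpace ℝ E] [CompleteSpace E] {s : Set E}
    (hs : Convex ℝ s) {f : E → ℝ} {f' : E → E} {L : ℝ} (hL : 0 ≤ L)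
    (hf : ∀ x ∈ s, HasGradientAt f (f' x) x)
    (hlip : ∀ x ∈ s, ∀ y ∈ s, ‖f' x - f' y‖ ≤ L * ‖x - y‖) {x y : E} (hx : x ∈ s) (hy : y ∈ s) :
    f y ≤ f x + inner ℝ (f' x) (y - x) + L * ‖y - x‖ ^ 2 := by
  have := norm_sub_sub_le_of_lipschitz_deriv hs hL (fun x hx => (hf x hx).hasFDerivAt)
    (fun x hx y hy => by rw [← map_sub, LinearIsometryEquiv.norm_map]; exact hlip x hx y hy) hx hy
  rw [InnerProductSpace.toDual_apply_apply] at this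
  have := (abs_le.1 this).2
  linarith

end

section

variable {N : ℕ} {d : Fin N → ℕ} {m : ℕ}

/-! ### Topology of the simplices -/

lemma isClosed_setOf_le_and_sum_eq_one (c : ℝ) :
    IsClosed {h : LowerVec d | (∀ p, c ≤ h p) ∧ ∀ i : Fin N, ∑ j : Fin (d i), h ⟨i, j⟩ = 1} := by
  have hc : ∀ p, Continuous fun h : LowerVec d => h p := fun p =>
    (EuclideanSpace.proj p : LowerVec d →L[ℝ] ℝ).continuous
  simp only [Set.ofPred_and, Set.ofPred_forall]
  exact (isClosed_iInter fun p => isClosed_le continuous_const (hc p)).inter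
    (isClosed_iInter fun i => isClosed_eq (continuous_finsetSum _ fun j _ => hc _)
      continuous_const)

lemma isCompact_simplexProd : IsCompact (simplexProd d) := by
  refine Metric.isCompact_of_isClosed_isBounded (isClosed_setOf_le_and_sum_eq_one 0) ?_
  refine (Metric.isBounded_closedBall (x := (0 : LowerVec d))
    (r := (Fintype.card (Σ i : Fin N, Fin (d i)) : ℝ) * 1)).subset fun h hh => ?_
  rw [mem_closedBall_zero_iff]
  refine norm_le_card_mul fun p => ?_
  rw [abs_of_nonneg (hh.1 p)]
  exact le_one_of_mem hh p

lemma simplexProd_nonempty (hd : ∀ i, 0 < d i) : (simplexProd d).Nonempty :=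
  ⟨softmax 0, softmax_mem hd 0⟩

lemma nuMin_pos {η Ωg : ℝ} (p : Σ i : Fin N, Fin (d i)) : 0 < nuMin d η Ωg := by
  refine div_pos (Real.exp_pos _) ?_
  have : d p.1 ≤ Finset.univ.sup d := Finset.le_sup (Finset.mem_univ _)
  exact_mod_cast (Fin.pos p.2).trans_le this

lemma truncSimplexProd_subset {η Ωg : ℝ} : truncSimplexProd d η Ωg ⊆ simplexProd d :=
  fun _ hh => ⟨fun p => (nuMin_pos p).le.trans (hh.1 p), hh.2⟩

lemma pos_of_mem_trunc {η Ωg : ℝ} {h : LowerVec d} (hh : h ∈ truncSimplexProd d η Ωg)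
    (p : Σ i : Fin N, Fin (d i)) : 0 < h p := (nuMin_pos p).trans_le (hh.1 p)

/-- A positive lower bound for the coordinates on the truncated simplices. It differs from `nuMin`
only when there are no coordinates, where `nuMin` is `_ / 0 = 0`. -/
lemma exists_pos_le_of_mem_trunc (d : Fin N → ℕ) (η Ωg : ℝ) :
    ∃ ν : ℝ, 0 < ν ∧ ∀ h ∈ truncSimplexProd d η Ωg, ∀ p, ν ≤ h p := by
  by_cases hp : Nonempty (Σ i : Fin N, Fin (d i))
  · exact ⟨nuMin d η Ωg, nuMin_pos hp.some, fun h hh => hh.1⟩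
  · exact ⟨1, one_pos, fun h _ p => (hp ⟨p⟩).elim⟩

/-! ### The entropy and its Bregman divergence -/

/-- The coordinatewise logarithm. -/
def logVec (h : LowerVec d) : LowerVec d := WithLp.toLp 2 fun p => Real.log (h p)

@[simp]
lemma logVec_apply (h : LowerVec d) (p : Σ i : Fin N, Fin (d i)) :
    logVec h p = Real.log (h p) := rfl

lemma negEntropy_eq (h : LowerVec d) :
    negEntropy h = ∑ p, (h p * Real.log (h p) - h p) := by
  rw [Fintype.sum_sigma]; rfl

lemma continuous_negEntropy : Continuous (negEntropy (d := d)) := by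
  have hc : ∀ p, Continuous fun h : LowerVec d => h p := fun p =>
    (EuclideanSpace.proj p : LowerVec d →L[ℝ] ℝ).continuous
  have : (negEntropy (d := d)) = fun h => ∑ p, (h p * Real.log (h p) - h p) :=
    funext negEntropy_eq
  rw [this]
  exact continuous_finsetSum _ fun p _ => (Real.continuous_mul_log.comp (hc p)).sub (hc p)

lemma hasGradientAt_negEntropy {h : LowerVec d} (hpos : ∀ p, 0 < h p) :
    HasGradientAt negEntropy (logVec h) h := by
  have : (negEntropy (d := d)) = fun h => ∑ p, (h p * Real.log (h p) - h p) :=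
    funext negEntropy_eq
  rw [hasGradientAt_iff_hasFDerivAt, this]
  have h1 : ∀ p, HasFDerivAt (fun h : LowerVec d => h p * Real.log (h p) - h p)
      (Real.log (h p) • (EuclideanSpace.proj p : LowerVec d →L[ℝ] ℝ)) h := fun p => by
    have hp : HasDerivAt (fun x : ℝ => x * Real.log x - x) (Real.log (h p)) (h p) := by
      have := (Real.hasDerivAt_mul_log (hpos p).ne').fun_sub (hasDerivAt_id' (h p))
      rwa [add_sub_cancel_right] at this
    exact hp.comp_hasFDerivAt h (EuclideanSpace.proj p : LowerVec d →L[ℝ] ℝ).hasFDerivAt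
  refine (HasFDerivAt.fun_sum fun p _ => h1 p).congr_fderiv ?_
  ext v
  simp [inner_eq_sum]

/-- The Bregman divergence of the entropy (the generalized Kullback–Leibler divergence). -/
def bregman (u h : LowerVec d) : ℝ :=
  ∑ p, (u p * (Real.log (u p) - Real.log (h p)) - u p + h p)

/-- A Pinsker-type bound in one coordinate. The constant `1 / 4` comes from comparing with the
squared Hellinger distance `(√a - √b)²`. -/
lemma sq_sub_le_bregman {a b : ℝ} (ha : 0 ≤ a) (ha1 : a ≤ 1) (hb : 0 < b) (hb1 : b ≤ 1) :
    (a - b) ^ 2 / 4 ≤ a * (Real.log a - Real.log b) - a + b := by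
  rcases ha.eq_or_lt with rfl | ha
  · nlinarith
  set s := √a with hs
  set t := √b with ht
  have hs0 : 0 < s := Real.sqrt_pos.2 ha
  have ht0 : 0 < t := Real.sqrt_pos.2 hb
  have hsa : s ^ 2 = a := Real.sq_sqrt ha.le
  have htb : t ^ 2 = b := Real.sq_sqrt hb.le
  have hs1 : s ≤ 1 := Real.sqrt_le_one.2 ha1
  have ht1 : t ≤ 1 := Real.sqrt_le_one.2 hb1
  have hlog : Real.log t - Real.log s ≤ t / s - 1 := by
    rw [← Real.log_div ht0.ne' hs0.ne']
    exact Real.log_le_sub_one_of_pos (by positivity)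
  rw [← hsa, ← htb, Real.log_pow, Real.log_pow]
  have h1 : s ^ 2 * (t / s - 1) = s * t - s ^ 2 := by field_simp
  have h2 : s ^ 2 * (Real.log t - Real.log s) ≤ s * t - s ^ 2 := by
    rw [← h1]; gcongr
  have h3 : (s ^ 2 - t ^ 2) ^ 2 ≤ 4 * (s - t) ^ 2 := by
    have : (s ^ 2 - t ^ 2) ^ 2 = (s + t) ^ 2 * (s - t) ^ 2 := by ring
    rw [this]
    gcongr
    nlinarith
  push_cast
  nlinarith

lemma norm_sub_sq_le_bregman {u h : LowerVec d} (hu : u ∈ simplexProd d)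
    (hh : h ∈ simplexProd d) (hpos : ∀ p, 0 < h p) : ‖u - h‖ ^ 2 ≤ 4 * bregman u h := by
  rw [norm_sq_eq_sum, bregman, Finset.mul_sum]
  refine Finset.sum_le_sum fun p _ => ?_
  have := sq_sub_le_bregman (hu.1 p) (le_one_of_mem hu p) (hpos p) (le_one_of_mem hh p)
  rw [PiLp.sub_apply]
  linarith

lemma bregman_le_card_div {u h : LowerVec d} (hu : u ∈ simplexProd d) (hh : h ∈ simplexProd d)
    {ν : ℝ} (hν : 0 < ν) (hνh : ∀ p, ν ≤ h p) :
    bregman u h ≤ (Fintype.card (Σ i : Fin N, Fin (d i)) : ℝ) / ν := by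
  have key : ∀ p, u p * (Real.log (u p) - Real.log (h p)) - u p + h p ≤ 1 / ν := fun p => by
    have hb : 0 < h p := hν.trans_le (hνh p)
    have hb1 := le_one_of_mem hh p
    have ha1 := le_one_of_mem hu p
    have h1 : (u p - h p) ^ 2 / h p ≤ 1 / ν := by
      have := hu.1 p
      refine div_le_div₀ zero_le_one ?_ hν (hνh p)
      nlinarith
    refine le_trans ?_ h1
    rcases (hu.1 p).eq_or_lt with h0 | ha
    · rw [← h0]
      simp only [zero_mul, sub_zero, zero_sub, zero_add, even_two, Even.neg_pow]
      rw [sq, mul_div_cancel_right₀ _ hb.ne']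
    · have h2 : Real.log (u p) - Real.log (h p) ≤ u p / h p - 1 := by
        rw [← Real.log_div ha.ne' hb.ne']
        exact Real.log_le_sub_one_of_pos (by positivity)
      have h3 : (u p - h p) ^ 2 / h p = u p * (u p / h p - 1) - u p + h p := by
        field_simp; ring
      rw [h3]
      gcongr
  calc bregman u h ≤ ∑ _p : (Σ i : Fin N, Fin (d i)), 1 / ν := Finset.sum_le_sum fun p _ => key p
    _ = _ := by simp [div_eq_mul_inv]

lemma bregman_self (h : LowerVec d) : bregman h h = 0 := by simp [bregman]

end

section

variable {N : ℕ} {d : Fin N → ℕ} {m : ℕ}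

/-! ### Assumptions on the lower level -/

/-- The assumptions on the lower level, with nonnegative Lipschitz constants, nonempty blocks and a
positive regularization parameter. -/
structure RegularLower (g : LowerVec d → UpperVec m → ℝ) (η Lg Ωg τh ρh Λ τy ρy : ℝ) : Prop
    extends LowerAssumptions g Lg Ωg τh ρh Λ τy ρy where
  dim_pos : ∀ i, 0 < d i
  eta_pos : 0 < η
  Lg_nonneg : 0 ≤ Lg
  τh_nonneg : 0 ≤ τh
  ρh_nonneg : 0 ≤ ρh
  Λ_nonneg : 0 ≤ Λ
  τy_nonneg : 0 ≤ τy
  ρy_nonneg : 0 ≤ ρy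

variable {g : LowerVec d → UpperVec m → ℝ} {η Lg Ωg τh ρh Λ τy ρy : ℝ}

lemma LowerAssumptions.regularLower (hg : LowerAssumptions g Lg Ωg τh ρh Λ τy ρy)
    (hd : ∀ i, 0 < d i) (hη : 0 < η) :
    RegularLower g η |Lg| Ωg |τh| |ρh| |Λ| |τy| |ρy| where
  convex := hg.convex
  differentiable := hg.differentiable
  differentiable_grad_lower := hg.differentiable_grad_lower
  differentiable_grad_upper := hg.differentiable_grad_upper
  lipschitz_grad := fun y h hh h' hh' => (hg.lipschitz_grad y h hh h' hh').trans
    (mul_le_mul_of_nonneg_right (le_abs_self _) (norm_nonneg _))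
  bounded_grad := hg.bounded_grad
  lipschitz_cross_lower := fun y h hh h' hh' => (hg.lipschitz_cross_lower y h hh h' hh').trans
    (mul_le_mul_of_nonneg_right (le_abs_self _) (norm_nonneg _))
  lipschitz_hess_lower := fun y h hh h' hh' => (hg.lipschitz_hess_lower y h hh h' hh').trans
    (mul_le_mul_of_nonneg_right (le_abs_self _) (norm_nonneg _))
  bounded_hess := fun y h hh => (hg.bounded_hess y h hh).trans (le_abs_self _)
  bounded_cross := fun y h hh => (hg.bounded_cross y h hh).trans (le_abs_self _)
  lipschitz_cross_upper := fun h hh y y' => (hg.lipschitz_cross_upper h hh y y').trans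
    (mul_le_mul_of_nonneg_right (le_abs_self _) (norm_nonneg _))
  lipschitz_hess_upper := fun h hh y y' => (hg.lipschitz_hess_upper h hh y y').trans
    (mul_le_mul_of_nonneg_right (le_abs_self _) (norm_nonneg _))
  dim_pos := hd
  eta_pos := hη
  Lg_nonneg := abs_nonneg _
  τh_nonneg := abs_nonneg _
  ρh_nonneg := abs_nonneg _
  Λ_nonneg := abs_nonneg _
  τy_nonneg := abs_nonneg _
  ρy_nonneg := abs_nonneg _

/-! ### The mirror descent step -/

lemma gradLower_regObj {h : LowerVec d} {y : UpperVec m} (hpos : ∀ p, 0 < h p)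
    (hdiff : DifferentiableAt ℝ (fun h' => g h' y) h) :
    gradLower (regObj g η) h y = gradLower g h y + η • logVec h := by
  refine HasGradientAt.gradient ?_
  have h1 := hdiff.hasGradientAt.hasFDerivAt.add
    ((hasGradientAt_negEntropy hpos).hasFDerivAt.const_mul η)
  rw [hasGradientAt_iff_hasFDerivAt]
  refine h1.congr_fderiv ?_
  rw [map_add, map_smul]
  rfl

lemma mirrorStep_eq_softmax {h : LowerVec d} (hpos : ∀ p, 0 < h p) (α : ℝ) (y : UpperVec m) :
    mirrorStep g η α h y = softmax (logVec h - α • gradLower (regObj g η) h y) := by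
  have : ∀ p, h p * Real.exp (-α * gradLower (regObj g η) h y p) =
      Real.exp ((logVec h - α • gradLower (regObj g η) h y) p) := fun p => by
    rw [PiLp.sub_apply, PiLp.smul_apply, smul_eq_mul, sub_eq_add_neg, Real.exp_add, logVec_apply,
      Real.exp_log (hpos p), neg_mul]
  ext p
  simp only [mirrorStep, softmax_apply, this]

/-- The logarithm of a mirror descent step is the logarithm of the point plus a multiple of the
gradient of `g^η`, up to a block-constant vector. -/
lemma exists_log_mirrorStep {h : LowerVec d} (hpos : ∀ p, 0 < h p) (α : ℝ) (y : UpperVec m) :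
    ∃ c : Fin N → ℝ, ∀ p, Real.log (mirrorStep g η α h y p) =
      Real.log (h p) - α * gradLower (regObj g η) h y p - c p.1 := by
  set u := logVec h - α • gradLower (regObj g η) h y with hu
  refine ⟨fun i => Real.log (∑ j : Fin (d i), Real.exp (u ⟨i, j⟩)), fun p => ?_⟩
  rw [mirrorStep_eq_softmax hpos, log_softmax]
  rfl

namespace RegularLower

variable (S : RegularLower g η Lg Ωg τh ρh Λ τy ρy)
include S

lemma hasGradientAt {h : LowerVec d} (hh : h ∈ simplexProd d) (y : UpperVec m) :
    HasGradientAt (fun h' => g h' y) (gradLower g h y) h :=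
  (S.differentiable h hh y).self_of_nhds.hasGradientAt

lemma gradLower_regObj_apply {h : LowerVec d} (hh : h ∈ simplexProd d) (hpos : ∀ p, 0 < h p)
    (y : UpperVec m) (p : Σ i : Fin N, Fin (d i)) :
    gradLower (regObj g η) h y p = gradLower g h y p + η * Real.log (h p) := by
  rw [gradLower_regObj hpos (S.differentiable h hh y).self_of_nhds]
  rfl

lemma mirrorStep_mem {h : LowerVec d} (hpos : ∀ p, 0 < h p) (α : ℝ) (y : UpperVec m) :
    mirrorStep g η α h y ∈ simplexProd d := by
  rw [mirrorStep_eq_softmax hpos]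
  exact softmax_mem S.dim_pos _

/-- The truncated simplices are invariant under mirror descent. Coordinatewise, the unnormalized
step `x_l = h_l^(1 - αη) exp (-α G_l)` satisfies `ν x_l ≤ x_p ((1 - αη) h_l + αη / d_i)` by the
weighted inequality of the arithmetic and geometric means. -/
lemma mirrorStep_mem_trunc {h : LowerVec d} (hh : h ∈ truncSimplexProd d η Ωg) {α : ℝ}
    (hα : 0 ≤ α) (hαη : α * η ≤ 1) (y : UpperVec m) :
    mirrorStep g η α h y ∈ truncSimplexProd d η Ωg := by
  have hpos := pos_of_mem_trunc hh
  have hH := truncSimplexProd_subset hh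
  refine ⟨fun p => ?_, (S.mirrorStep_mem hpos α y).2⟩
  rw [mirrorStep_eq_softmax hpos, softmax_apply, le_div_iff₀ (sum_exp_pos _ p)]
  set u := logVec h - α • gradLower (regObj g η) h y with hu
  have hup : ∀ q, u q = (1 - α * η) * Real.log (h q) - α * gradLower g h y q := fun q => by
    rw [hu, PiLp.sub_apply, PiLp.smul_apply, smul_eq_mul, S.gradLower_regObj_apply hH hpos,
      logVec_apply]
    ring
  set ν := nuMin d η Ωg with hν
  have hν0 : 0 < ν := nuMin_pos p
  have hdp : (0 : ℝ) < d p.1 := by exact_mod_cast S.dim_pos p.1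
  have hη := S.eta_pos
  have hlogν : α * η * (Real.log ν + Real.log (d p.1)) ≤ -(2 * α * Ωg) := by
    have h1 : ν * d p.1 ≤ Real.exp (-(2 * Ωg / η)) := by
      rw [hν, nuMin, div_mul_eq_mul_div]
      have h2 : d p.1 ≤ Finset.univ.sup d := Finset.le_sup (Finset.mem_univ _)
      have h3 : (d p.1 : ℝ) ≤ ((Finset.univ.sup d : ℕ) : ℝ) := by exact_mod_cast h2
      rw [div_le_iff₀ (hdp.trans_le h3)]
      gcongr
    have h4 := Real.log_le_log (by positivity) h1
    rw [Real.log_exp, Real.log_mul hν0.ne' hdp.ne'] at h4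
    calc α * η * (Real.log ν + Real.log (d p.1)) ≤ α * η * (-(2 * Ωg / η)) := by gcongr
      _ = _ := by field_simp
  have key : ∀ j : Fin (d p.1), ν * Real.exp (u ⟨p.1, j⟩) ≤
      Real.exp (u p) * ((1 - α * η) * h ⟨p.1, j⟩ + α * η * (1 / d p.1)) := fun j => by
    have hj := hpos ⟨p.1, j⟩
    have amgm := Real.geom_mean_le_arith_mean2_weighted (sub_nonneg.2 hαη)
      (by positivity : 0 ≤ α * η)
      hj.le (by positivity : (0 : ℝ) ≤ 1 / d p.1) (by ring)
    refine le_trans ?_ (mul_le_mul_of_nonneg_left amgm (Real.exp_pos _).le)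
    rw [Real.rpow_def_of_pos hj, Real.rpow_def_of_pos (by positivity : (0 : ℝ) < 1 / d p.1),
      ← Real.exp_add, ← Real.exp_add]
    nth_rw 1 [← Real.exp_log hν0]
    rw [← Real.exp_add, Real.exp_le_exp, hup, hup, one_div, Real.log_inv]
    have hG := S.bounded_grad y h hH
    have g1 := (abs_le.1 ((abs_apply_le_norm (gradLower g h y) p).trans hG)).2
    have g2 := (abs_le.1 ((abs_apply_le_norm (gradLower g h y) ⟨p.1, j⟩).trans hG)).1
    have hlp : Real.log ν ≤ Real.log (h p) := Real.log_le_log hν0 (hh.1 p)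
    have h5 := mul_le_mul_of_nonneg_left hlp (sub_nonneg.2 hαη)
    have h6 := mul_le_mul_of_nonneg_left g1 hα
    have h7 := mul_le_mul_of_nonneg_left g2 hα
    linarith
  rw [Finset.mul_sum]
  refine (Finset.sum_le_sum fun j _ => key j).trans_eq ?_
  rw [← Finset.mul_sum, Finset.sum_add_distrib, ← Finset.mul_sum, hH.2 p.1]
  simp
  field_simp
  ring

/-- The basic inequality of mirror descent: `g^η` is `η`-strongly convex and `(4 L_g + η)`-smooth
relative to the entropy. -/
lemma bregman_mirrorStep_le {h u : LowerVec d} (hh : h ∈ simplexProd d) (hpos : ∀ p, 0 < h p)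
    (hu : u ∈ simplexProd d) {α : ℝ} (hα : 0 ≤ α) (hα' : α * (4 * Lg + η) ≤ 1)
    (y : UpperVec m) :
    bregman u (mirrorStep g η α h y) ≤ (1 - α * η) * bregman u h +
      α * (regObj g η u y - regObj g η (mirrorStep g η α h y) y) := by
  obtain ⟨c, hc⟩ := exists_log_mirrorStep (g := g) (η := η) hpos α y
  have hx := S.mirrorStep_mem hpos α y
  set x := mirrorStep g η α h y with hxdef
  have hxh : ‖x - h‖ ^ 2 ≤ 4 * bregman x h := norm_sub_sq_le_bregman hx hh hpos
  -- three-point identity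
  have e1 : bregman u x + bregman x h - bregman u h = α * ∑ p, (u p - x p) * gradLower g h y p +
      α * (η * ∑ p, (u p - x p) * Real.log (h p)) := by
    have h0 := inner_blockConst (sub_mem_tangent hu hx) c
    have h1 : bregman u x + bregman x h - bregman u h =
        (∑ p, (α * ((u p - x p) * gradLower g h y p) +
        α * (η * ((u p - x p) * Real.log (h p))))) +
          ∑ p : (Σ i : Fin N, Fin (d i)), (u - x) p * c p.1 := by
      rw [bregman, bregman, bregman, ← Finset.sum_add_distrib, ← Finset.sum_sub_distrib,
        ← Finset.sum_add_distrib]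
      refine Finset.sum_congr rfl fun p _ => ?_
      rw [hc p, S.gradLower_regObj_apply hh hpos, PiLp.sub_apply]
      ring
    rw [h1, h0, add_zero, Finset.sum_add_distrib, ← Finset.mul_sum, ← Finset.mul_sum,
      ← Finset.mul_sum]
  have e2 : ∑ p, (u p - x p) * gradLower g h y p =
      inner ℝ (gradLower g h y) (u - h) - inner ℝ (gradLower g h y) (x - h) := by
    rw [inner_eq_sum, inner_eq_sum, ← Finset.sum_sub_distrib]
    refine Finset.sum_congr rfl fun p _ => ?_
    simp only [PiLp.sub_apply]
    ring
  have e3 : ∑ p, (u p - x p) * Real.log (h p) =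
      negEntropy u - negEntropy x - bregman u h + bregman x h := by
    rw [negEntropy_eq, negEntropy_eq, bregman, bregman, ← Finset.sum_sub_distrib,
      ← Finset.sum_sub_distrib, ← Finset.sum_add_distrib]
    exact Finset.sum_congr rfl fun p _ => by ring
  have h1 := add_inner_gradient_le (S.convex y) hh hu (S.hasGradientAt hh y)
  have h2 := descent_inequality convex_simplexProd S.Lg_nonneg (fun z hz => S.hasGradientAt hz y)
    (S.lipschitz_grad y) hh hx
  have h3 : ∑ p, (u p - x p) * gradLower g h y p ≤ g u y - g x y + Lg * (4 * bregman x h) := by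
    rw [e2]
    have := mul_le_mul_of_nonneg_left hxh S.Lg_nonneg
    linarith
  have h4 := mul_le_mul_of_nonneg_left h3 hα
  have hB : 0 ≤ bregman x h := by nlinarith [sq_nonneg ‖x - h‖]
  have h5 := mul_le_mul_of_nonneg_right hα' hB
  rw [e3] at e1
  simp only [regObj]
  nlinarith

omit S in
lemma lowerIter_succ (α : ℝ) (h : LowerVec d) (y : UpperVec m) (t : ℕ) :
    lowerIter g η α h y (t + 1) = mirrorStep g η α (lowerIter g η α h y t) y := rfl

lemma step_mul_eta_le_one {α : ℝ} (hα : 0 ≤ α) (hα' : α * (4 * Lg + η) ≤ 1) : α * η ≤ 1 := by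
  have := mul_nonneg hα S.Lg_nonneg
  linarith

lemma lowerIter_mem_trunc {h : LowerVec d} (hh : h ∈ truncSimplexProd d η Ωg) {α : ℝ}
    (hα : 0 ≤ α) (hα' : α * (4 * Lg + η) ≤ 1) (y : UpperVec m) (t : ℕ) :
    lowerIter g η α h y t ∈ truncSimplexProd d η Ωg := by
  induction t with
  | zero => exact hh
  | succ t ih => exact S.mirrorStep_mem_trunc ih hα (S.step_mul_eta_le_one hα hα') y

lemma bregman_lowerIter_le {h u : LowerVec d} (hh : h ∈ truncSimplexProd d η Ωg) {y : UpperVec m}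
    (hu : IsLowerSolution g η y u) {α : ℝ} (hα : 0 ≤ α) (hα' : α * (4 * Lg + η) ≤ 1) (t : ℕ) :
    bregman u (lowerIter g η α h y t) ≤ (1 - α * η) ^ t * bregman u h := by
  induction t with
  | zero => simp [lowerIter]
  | succ t ih =>
    have hm := S.lowerIter_mem_trunc hh hα hα' y t
    have hαη := S.step_mul_eta_le_one hα hα'
    have h1 := S.bregman_mirrorStep_le (truncSimplexProd_subset hm) (pos_of_mem_trunc hm) hu.1
      hα hα' y
    have h2 : regObj g η u y ≤ regObj g η (mirrorStep g η α (lowerIter g η α h y t) y) y :=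
      hu.2 (S.mirrorStep_mem (pos_of_mem_trunc hm) α y)
    rw [lowerIter_succ]
    have h3 := mul_le_mul_of_nonneg_left ih (sub_nonneg.2 hαη)
    have h4 := mul_nonneg hα (sub_nonneg.2 h2)
    rw [pow_succ]
    linarith

/-- Linear convergence of the lower-level iterates, uniformly in the starting point. -/
lemma norm_lowerIter_sub_le {ν : ℝ} (hν : 0 < ν)
    (hνt : ∀ h ∈ truncSimplexProd d η Ωg, ∀ p, ν ≤ h p) {h u : LowerVec d}
    (hh : h ∈ truncSimplexProd d η Ωg) {y : UpperVec m} (hu : IsLowerSolution g η y u) {α : ℝ}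
    (hα : 0 ≤ α) (hα' : α * (4 * Lg + η) ≤ 1) (t : ℕ) :
    ‖lowerIter g η α h y t - u‖ ≤
      √(4 * ((Fintype.card (Σ i : Fin N, Fin (d i)) : ℝ) / ν)) * √(1 - α * η) ^ t := by
  have hαη := S.step_mul_eta_le_one hα hα'
  have hm := S.lowerIter_mem_trunc hh hα hα' y t
  have h1 := norm_sub_sq_le_bregman hu.1 (truncSimplexProd_subset hm) (pos_of_mem_trunc hm)
  have h2 := S.bregman_lowerIter_le hh hu hα hα' t
  have h3 := bregman_le_card_div hu.1 (truncSimplexProd_subset hh) hν (hνt h hh)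
  have h4 := mul_le_mul_of_nonneg_left h3 (pow_nonneg (sub_nonneg.2 hαη) t)
  refine abs_le_of_sq_le_sq' ?_ (by positivity) |>.2
  rw [mul_pow, Real.sq_sqrt (by positivity), ← pow_mul, mul_comm t 2, pow_mul,
    Real.sq_sqrt (sub_nonneg.2 hαη), norm_sub_rev]
  linarith

/-! ### The lower-level solution -/

lemma truncSimplexProd_nonempty : (truncSimplexProd d η Ωg).Nonempty := by
  obtain ⟨y⟩ : Nonempty (UpperVec m) := inferInstance
  obtain ⟨h, hh⟩ := simplexProd_nonempty S.dim_pos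
  have hΩ : 0 ≤ Ωg := (norm_nonneg _).trans (S.bounded_grad y h hh)
  have hη := S.eta_pos
  refine ⟨WithLp.toLp 2 fun p => 1 / (d p.1 : ℝ), fun p => ?_, fun i => ?_⟩
  · have h2 : d p.1 ≤ Finset.univ.sup d := Finset.le_sup (Finset.mem_univ _)
    have h3 : (d p.1 : ℝ) ≤ ((Finset.univ.sup d : ℕ) : ℝ) := by exact_mod_cast h2
    have h4 : (0 : ℝ) < d p.1 := by exact_mod_cast S.dim_pos p.1
    refine div_le_div₀ zero_le_one ?_ h4 h3
    rw [Real.exp_le_one_iff]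
    have : 0 ≤ 2 * Ωg / η := by positivity
    linarith
  · have h4 : (d i : ℝ) ≠ 0 := by exact_mod_cast (S.dim_pos i).ne'
    simp [h4]

lemma exists_isLowerSolution (y : UpperVec m) : ∃ h, IsLowerSolution g η y h := by
  have hc : ContinuousOn (fun h => regObj g η h y) (simplexProd d) := fun h hh =>
    ((S.hasGradientAt hh y).continuousAt.add
      (continuous_negEntropy.continuousAt.const_mul η)).continuousWithinAt
  obtain ⟨h, hh, hmin⟩ := isCompact_simplexProd.exists_isMinOn (simplexProd_nonempty S.dim_pos) hc
  exact ⟨h, hh, hmin⟩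

/-- A step size for which mirror descent converges. -/
lemma exists_step :
    ∃ α : ℝ, 0 < α ∧ α * (4 * Lg + η) ≤ 1 := by
  have := S.eta_pos
  have := S.Lg_nonneg
  exact ⟨(4 * Lg + η)⁻¹, by positivity, (inv_mul_cancel₀ (by positivity)).le⟩

/-- Every solution is the limit of mirror descent started at a fixed point of the truncated
simplices, which gives uniqueness and membership in the truncated simplices at once. -/
lemma tendsto_lowerIter {h u : LowerVec d} (hh : h ∈ truncSimplexProd d η Ωg) {y : UpperVec m}
    (hu : IsLowerSolution g η y u) {α : ℝ} (hα : 0 < α) (hα' : α * (4 * Lg + η) ≤ 1) :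
    Filter.Tendsto (lowerIter g η α h y) Filter.atTop (𝓝 u) := by
  obtain ⟨ν, hν, hνt⟩ := exists_pos_le_of_mem_trunc d η Ωg
  rw [tendsto_iff_norm_sub_tendsto_zero]
  refine squeeze_zero (fun _ => norm_nonneg _)
    (fun t => S.norm_lowerIter_sub_le hν hνt hh hu hα.le hα' t) ?_
  have hq : √(1 - α * η) < 1 := by
    rw [Real.sqrt_lt' one_pos]
    have := mul_pos hα S.eta_pos
    linarith
  simpa using (tendsto_pow_atTop_nhds_zero_of_lt_one (Real.sqrt_nonneg _) hq).const_mul _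

lemma isLowerSolution_unique {y : UpperVec m} {u u' : LowerVec d}
    (hu : IsLowerSolution g η y u) (hu' : IsLowerSolution g η y u') : u = u' := by
  obtain ⟨h, hh⟩ := S.truncSimplexProd_nonempty
  obtain ⟨α, hα, hα'⟩ := S.exists_step
  exact tendsto_nhds_unique (S.tendsto_lowerIter hh hu hα hα') (S.tendsto_lowerIter hh hu' hα hα')

lemma isLowerSolution_lowerSolution (y : UpperVec m) :
    IsLowerSolution g η y (lowerSolution g η y) :=
  Classical.epsilon_spec (S.exists_isLowerSolution y)

lemma isLowerSolution_iff (y : UpperVec m) (h : LowerVec d) :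
    IsLowerSolution g η y h ↔ h = lowerSolution g η y :=
  ⟨fun hh => S.isLowerSolution_unique hh (S.isLowerSolution_lowerSolution y),
    fun hh => hh ▸ S.isLowerSolution_lowerSolution y⟩

lemma lowerSolution_mem_trunc (y : UpperVec m) :
    lowerSolution g η y ∈ truncSimplexProd d η Ωg := by
  obtain ⟨h, hh⟩ := S.truncSimplexProd_nonempty
  obtain ⟨α, hα, hα'⟩ := S.exists_step
  exact (isClosed_setOf_le_and_sum_eq_one _).mem_of_tendsto
    (S.tendsto_lowerIter hh (S.isLowerSolution_lowerSolution y) hα hα')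
    (Filter.Eventually.of_forall fun t => S.lowerIter_mem_trunc hh hα.le hα' y t)

lemma lowerSolution_mem (y : UpperVec m) : lowerSolution g η y ∈ simplexProd d :=
  truncSimplexProd_subset (S.lowerSolution_mem_trunc y)

lemma lowerSolution_pos (y : UpperVec m) (p : Σ i : Fin N, Fin (d i)) :
    0 < lowerSolution g η y p := pos_of_mem_trunc (S.lowerSolution_mem_trunc y) p

lemma mirrorStep_lowerSolution {α : ℝ} (hα : 0 ≤ α) (hα' : α * (4 * Lg + η) ≤ 1)
    (y : UpperVec m) :
    mirrorStep g η α (lowerSolution g η y) y = lowerSolution g η y := by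
  have hu := S.isLowerSolution_lowerSolution y
  have ht := S.lowerSolution_mem_trunc y
  have h1 := S.bregman_lowerIter_le ht hu hα hα' 1
  rw [bregman_self, mul_zero] at h1
  have hm := S.lowerIter_mem_trunc ht hα hα' y 1
  have h2 := norm_sub_sq_le_bregman hu.1 (truncSimplexProd_subset hm) (pos_of_mem_trunc hm)
  have h3 : ‖lowerSolution g η y - lowerIter g η α (lowerSolution g η y) y 1‖ = 0 := by
    have := norm_nonneg (lowerSolution g η y - lowerIter g η α (lowerSolution g η y) y 1)
    nlinarith
  exact (sub_eq_zero.1 (norm_eq_zero.1 h3)).symm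

/-- The optimality condition: at the solution, `∇_h g^η` is orthogonal to the tangent space. It is
read off the fixed point equation of mirror descent. -/
lemma inner_grad_lowerSolution (y : UpperVec m) {v : LowerVec d} (hv : v ∈ tangent d) :
    inner ℝ v (gradLower g (lowerSolution g η y) y + η • logVec (lowerSolution g η y)) = 0 := by
  obtain ⟨α, hα, hα'⟩ := S.exists_step
  have hpos := S.lowerSolution_pos y
  obtain ⟨c, hc⟩ := exists_log_mirrorStep (g := g) (η := η) hpos α y
  rw [S.mirrorStep_lowerSolution hα.le hα' y] at hc
  rw [← gradLower_regObj hpos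
    (S.differentiable _ (S.lowerSolution_mem y) y).self_of_nhds, inner_eq_sum,
    ← inner_blockConst hv fun i => -(c i) / α]
  refine Finset.sum_congr rfl fun p _ => ?_
  have := hc p
  congr 1
  field_simp
  linarith

end RegularLower

end

section

variable {N : ℕ} {d : Fin N → ℕ} {m : ℕ}

/-! ### Scalar and coordinatewise estimates for the logarithm -/

lemma sq_sub_le_mul_log_sub {a b : ℝ} (ha : 0 < a) (ha1 : a ≤ 1) (hb : 0 < b) (hb1 : b ≤ 1) :
    (a - b) ^ 2 ≤ (a - b) * (Real.log a - Real.log b) := by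
  wlog hab : b ≤ a generalizing a b
  · have := this hb hb1 ha ha1 (le_of_not_ge hab)
    nlinarith
  have h1 : Real.log b - Real.log a ≤ b / a - 1 := by
    rw [← Real.log_div hb.ne' ha.ne']
    exact Real.log_le_sub_one_of_pos (by positivity)
  have h2 : a - b ≤ 1 - b / a := by
    rw [le_sub_iff_add_le, ← le_sub_iff_add_le', div_le_iff₀ ha]
    nlinarith
  rw [sq]
  exact mul_le_mul_of_nonneg_left (by linarith) (sub_nonneg.2 hab)

lemma norm_sub_sq_le_inner_logVec {x x' : LowerVec d} (hx : x ∈ simplexProd d)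
    (hpos : ∀ p, 0 < x p) (hx' : x' ∈ simplexProd d) (hpos' : ∀ p, 0 < x' p) :
    ‖x' - x‖ ^ 2 ≤ inner ℝ (x' - x) (logVec x' - logVec x) := by
  rw [norm_sq_eq_sum, inner_eq_sum]
  exact Finset.sum_le_sum fun p _ =>
    sq_sub_le_mul_log_sub (hpos' p) (le_one_of_mem hx' p) (hpos p) (le_one_of_mem hx p)

lemma abs_log_sub_sub_le {a b ν : ℝ} (hν : 0 < ν) (ha : ν ≤ a) (hb : ν ≤ b) :
    |Real.log b - Real.log a - a⁻¹ * (b - a)| ≤ (ν⁻¹) ^ 2 * (b - a) ^ 2 := by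
  have ha0 := hν.trans_le ha
  have hb0 := hν.trans_le hb
  have h1 : Real.log b - Real.log a ≤ b / a - 1 := by
    rw [← Real.log_div hb0.ne' ha0.ne']
    exact Real.log_le_sub_one_of_pos (by positivity)
  have h2 : Real.log a - Real.log b ≤ a / b - 1 := by
    rw [← Real.log_div ha0.ne' hb0.ne']
    exact Real.log_le_sub_one_of_pos (by positivity)
  have h3 : b / a - 1 = a⁻¹ * (b - a) := by field_simp
  have h4 : a⁻¹ * (b - a) + (a / b - 1) = a⁻¹ * b⁻¹ * (b - a) ^ 2 := by field_simp; ring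
  have h5 : a⁻¹ * b⁻¹ * (b - a) ^ 2 ≤ (ν⁻¹) ^ 2 * (b - a) ^ 2 := by
    rw [sq (ν⁻¹)]
    gcongr
  have h6 : 0 ≤ (ν⁻¹) ^ 2 * (b - a) ^ 2 := by positivity
  rw [abs_le]
  constructor <;> linarith

lemma norm_logVec_sub_sub_le {x x' : LowerVec d} {ν : ℝ} (hν : 0 < ν) (hx : ∀ p, ν ≤ x p)
    (hx' : ∀ p, ν ≤ x' p) :
    ‖logVec x' - logVec x - diagOp (fun p => (x p)⁻¹) (x' - x)‖ ≤
      (Fintype.card (Σ i : Fin N, Fin (d i)) : ℝ) * (ν⁻¹) ^ 2 * ‖x' - x‖ ^ 2 := by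
  rw [mul_assoc]
  refine norm_le_card_mul fun p => (abs_log_sub_sub_le hν (hx p) (hx' p)).trans ?_
  refine mul_le_mul_of_nonneg_left ?_ (by positivity)
  rw [← sq_abs]
  exact pow_le_pow_left₀ (abs_nonneg _) (abs_apply_le_norm (x' - x) p) 2

lemma norm_diagOp_inv_le {x : LowerVec d} {ν : ℝ} (hν : 0 < ν) (hx : ∀ p, ν ≤ x p) :
    ‖diagOp (fun p => (x p)⁻¹)‖ ≤ ν⁻¹ := by
  refine norm_diagOp_le (by positivity) fun p => ?_
  rw [abs_of_pos (inv_pos.2 (hν.trans_le (hx p)))]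
  exact inv_anti₀ hν (hx p)

lemma norm_diagOp_inv_sub_le {x x' : LowerVec d} {ν : ℝ} (hν : 0 < ν) (hx : ∀ p, ν ≤ x p)
    (hx' : ∀ p, ν ≤ x' p) :
    ‖diagOp (fun p => (x' p)⁻¹) - diagOp (fun p => (x p)⁻¹)‖ ≤ (ν⁻¹) ^ 2 * ‖x' - x‖ := by
  have e : diagOp (fun p => (x' p)⁻¹) - diagOp (fun p => (x p)⁻¹) =
      diagOp (fun p => (x' p)⁻¹ - (x p)⁻¹) := by
    ext v p
    simp [sub_mul]
  rw [e]
  refine norm_diagOp_le (by positivity) fun p => ?_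
  have h1 := hν.trans_le (hx p)
  have h2 := hν.trans_le (hx' p)
  have e2 : (x' p)⁻¹ - (x p)⁻¹ = -((x' p)⁻¹ * (x p)⁻¹ * (x' - x) p) := by
    rw [PiLp.sub_apply]; field_simp; ring
  rw [e2, abs_neg, abs_mul, abs_of_pos (by positivity), sq]
  gcongr
  · exact hx' p
  · exact hx p
  · exact abs_apply_le_norm _ p

/-- Cancelling one factor of a norm. -/
lemma norm_le_of_mul_sq_le {E : Type*} [NormedAddCommGroup E] {v : E} {η b : ℝ} (hη : 0 < η)
    (hb : 0 ≤ b) (h : η * ‖v‖ ^ 2 ≤ ‖v‖ * b) : ‖v‖ ≤ b / η := by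
  rw [le_div_iff₀ hη]
  rcases (norm_nonneg v).eq_or_lt with h0 | h0
  · rw [← h0, zero_mul]; exact hb
  · refine le_of_mul_le_mul_left ?_ h0
    linarith

/-! ### The Hessian on the tangent space -/

/-- The Hessian of `g^η(·, y)` at a positive point `h`. -/
def regHess (g : LowerVec d → UpperVec m → ℝ) (η : ℝ) (h : LowerVec d) (y : UpperVec m) :
    LowerVec d →L[ℝ] LowerVec d :=
  hessLower g h y + η • diagOp (fun p => (h p)⁻¹)

variable {g : LowerVec d → UpperVec m → ℝ} {η Lg Ωg τh ρh Λ τy ρy : ℝ}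

lemma regHess_apply (h : LowerVec d) (y : UpperVec m) (v : LowerVec d) :
    regHess g η h y v = hessLower g h y v + η • diagOp (fun p => (h p)⁻¹) v := rfl

/-- The linearized optimality condition, which characterizes the derivative `R` of `h^*` at `y`. -/
def IsImplicitDeriv (g : LowerVec d → UpperVec m → ℝ) (η : ℝ) (y : UpperVec m)
    (R : UpperVec m →L[ℝ] LowerVec d) : Prop :=
  (∀ w, R w ∈ tangent d) ∧ ∀ w, ∀ v ∈ tangent d, inner ℝ v
    (regHess g η (lowerSolution g η y) y (R w) + crossDeriv g (lowerSolution g η y) y w) = 0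

namespace RegularLower

variable (S : RegularLower g η Lg Ωg τh ρh Λ τy ρy)
include S

lemma hasFDerivAt_gradLower {h : LowerVec d} (hh : h ∈ simplexProd d) (y : UpperVec m) :
    HasFDerivAt (fun h' => gradLower g h' y) (hessLower g h y) h :=
  (S.differentiable_grad_lower h hh y).hasFDerivAt

lemma hasFDerivAt_gradLower_upper {h : LowerVec d} (hh : h ∈ simplexProd d) (y : UpperVec m) :
    HasFDerivAt (fun y' => gradLower g h y') (crossDeriv g h y) y :=
  (S.differentiable_grad_upper h hh y).hasFDerivAt

lemma inner_hessLower_comm {h : LowerVec d} (hh : h ∈ simplexProd d) (y : UpperVec m)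
    (v w : LowerVec d) :
    inner ℝ v (hessLower g h y w) = inner ℝ w (hessLower g h y v) := by
  have h1 : ∀ᶠ h' in 𝓝 h, HasFDerivAt (fun h'' => g h'' y)
      ((innerSL ℝ : LowerVec d →L[ℝ] LowerVec d →L[ℝ] ℝ) (gradLower g h' y)) h' := by
    filter_upwards [S.differentiable h hh y] with h' hh'
    exact hh'.hasGradientAt.hasFDerivAt
  have h2 := (innerSL ℝ : LowerVec d →L[ℝ] LowerVec d →L[ℝ] ℝ).hasFDerivAt.comp h
    (S.hasFDerivAt_gradLower hh y)
  have := second_derivative_symmetric_of_eventually_of_real h1 h2 w v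
  rw [real_inner_comm, real_inner_comm _ w]
  exact this

lemma inner_gradLower_sub_nonneg {h h' : LowerVec d} (hh : h ∈ simplexProd d)
    (hh' : h' ∈ simplexProd d) (y : UpperVec m) :
    0 ≤ inner ℝ (h' - h) (gradLower g h' y - gradLower g h y) := by
  have h1 := add_inner_gradient_le (S.convex y) hh hh' (S.hasGradientAt hh y)
  have h2 := add_inner_gradient_le (S.convex y) hh' hh (S.hasGradientAt hh' y)
  rw [← neg_sub h' h, inner_neg_right] at h2
  rw [inner_sub_right, real_inner_comm _ (h' - h), real_inner_comm _ (h' - h)]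
  linarith

/-- By convexity, the Hessian is positive semidefinite on the tangent space. -/
lemma inner_hessLower_nonneg {h : LowerVec d} (hh : h ∈ simplexProd d) (hpos : ∀ p, 0 < h p)
    (y : UpperVec m) {v : LowerVec d} (hv : v ∈ tangent d) :
    0 ≤ inner ℝ v (hessLower g h y v) := by
  have hline : HasDerivAt (fun t : ℝ => h + t • v) v 0 := by
    simpa using ((hasDerivAt_id (0 : ℝ)).smul_const v).const_add h
  have hgrad : HasDerivAt (fun t : ℝ => inner ℝ v (gradLower g (h + t • v) y))
      (inner ℝ v (hessLower g h y v)) 0 := by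
    have h1 : HasFDerivAt (fun h' => gradLower g h' y) (hessLower g h y) (h + (0 : ℝ) • v) := by
      simpa using S.hasFDerivAt_gradLower hh y
    have h2 := (innerSL ℝ v).hasFDerivAt.comp_hasDerivAt (0 : ℝ) (h1.comp_hasDerivAt (0 : ℝ) hline)
    exact h2
  have hmem : ∀ᶠ t in 𝓝[>] (0 : ℝ), h + t • v ∈ simplexProd d := by
    refine Filter.Eventually.filter_mono nhdsWithin_le_nhds ?_
    have h1 : ∀ᶠ t in 𝓝 (0 : ℝ), ∀ p, 0 < (h + t • v) p := by
      refine Filter.eventually_all.2 fun p => ?_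
      have hc : Continuous fun t : ℝ => (h + t • v) p := by
        simp only [PiLp.add_apply, PiLp.smul_apply]; fun_prop
      exact hc.continuousAt.eventually_const_lt (by simpa using hpos p)
    filter_upwards [h1] with t ht
    refine ⟨fun p => (ht p).le, fun i => ?_⟩
    simp only [PiLp.add_apply, PiLp.smul_apply, smul_eq_mul, Finset.sum_add_distrib, hh.2 i,
      ← Finset.mul_sum, hv i, mul_zero, add_zero]
  refine ge_of_tendsto hgrad.tendsto_slope_zero_right ?_
  filter_upwards [hmem, self_mem_nhdsWithin] with t ht ht0
  have ht0 : 0 < t := ht0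
  have h1 := S.inner_gradLower_sub_nonneg hh ht y
  rw [add_sub_cancel_left, inner_smul_left, inner_sub_right] at h1
  have h2 := nonneg_of_mul_nonneg_right h1 ht0
  simp only [zero_add, zero_smul, add_zero, smul_eq_mul]
  exact mul_nonneg (inv_pos.2 ht0).le h2

lemma eta_mul_norm_sq_le {h : LowerVec d} (hh : h ∈ simplexProd d) (hpos : ∀ p, 0 < h p)
    (y : UpperVec m) {v : LowerVec d} (hv : v ∈ tangent d) :
    η * ‖v‖ ^ 2 ≤ inner ℝ v (regHess g η h y v) := by
  have h1 := S.inner_hessLower_nonneg hh hpos y hv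
  have h2 : ‖v‖ ^ 2 ≤ inner ℝ v (diagOp (fun p => (h p)⁻¹) v) := by
    rw [norm_sq_eq_sum, inner_eq_sum]
    refine Finset.sum_le_sum fun p _ => ?_
    have h3 : 1 ≤ (h p)⁻¹ := (one_le_inv₀ (hpos p)).2 (le_one_of_mem hh p)
    rw [diagOp_apply]
    nlinarith [sq_nonneg (v p)]
  rw [regHess_apply, inner_add_right, inner_smul_right]
  have := mul_le_mul_of_nonneg_left h2 S.eta_pos.le
  linarith

/-! ### Expansion of the gradient in both variables -/

lemma norm_gradLower_upper_sub_le {h : LowerVec d} (hh : h ∈ simplexProd d) (y y' : UpperVec m) :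
    ‖gradLower g h y' - gradLower g h y‖ ≤ Λ * ‖y' - y‖ :=
  convex_univ.norm_image_sub_le_of_norm_hasFDerivWithin_le
    (fun z _ => (S.hasFDerivAt_gradLower_upper hh z).hasFDerivWithinAt)
    (fun z _ => S.bounded_cross z h hh) (Set.mem_univ y) (Set.mem_univ y')

lemma norm_gradLower_expansion_le {h h' : LowerVec d} (hh : h ∈ simplexProd d)
    (hh' : h' ∈ simplexProd d) (y y' : UpperVec m) :
    ‖gradLower g h' y' - gradLower g h y -
        (hessLower g h y (h' - h) + crossDeriv g h y (y' - y))‖ ≤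
      ρh * ‖h' - h‖ ^ 2 + τy * ‖y' - y‖ ^ 2 + τh * ‖h' - h‖ * ‖y' - y‖ := by
  have h1 := norm_sub_sub_le_of_lipschitz_deriv convex_simplexProd S.ρh_nonneg
    (fun z hz => S.hasFDerivAt_gradLower hz y) (S.lipschitz_hess_lower y) hh hh'
  have h2 := norm_sub_sub_le_of_lipschitz_deriv convex_univ S.τy_nonneg
    (fun z _ => S.hasFDerivAt_gradLower_upper hh' z)
    (fun z _ z' _ => S.lipschitz_cross_upper h' hh' z z') (Set.mem_univ y) (Set.mem_univ y')
  have h3 : ‖(crossDeriv g h' y - crossDeriv g h y) (y' - y)‖ ≤ τh * ‖h' - h‖ * ‖y' - y‖ :=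
    ContinuousLinearMap.le_of_opNorm_le _ (S.lipschitz_cross_lower y h' hh' h hh) _
  have e : gradLower g h' y' - gradLower g h y -
        (hessLower g h y (h' - h) + crossDeriv g h y (y' - y)) =
      (gradLower g h' y - gradLower g h y - hessLower g h y (h' - h)) +
      (gradLower g h' y' - gradLower g h' y - crossDeriv g h' y (y' - y)) +
      (crossDeriv g h' y - crossDeriv g h y) (y' - y) := by
    rw [_root_.sub_apply]; abel
  rw [e]
  exact norm_add₃_le.trans (by gcongr)

/-! ### Differentiability of the lower-level solution -/

lemma lowerSolution_sub_mem_tangent (y y' : UpperVec m) :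
    lowerSolution g η y' - lowerSolution g η y ∈ tangent d :=
  sub_mem_tangent (S.lowerSolution_mem y') (S.lowerSolution_mem y)

lemma norm_lowerSolution_sub_le (y y' : UpperVec m) :
    ‖lowerSolution g η y' - lowerSolution g η y‖ ≤ Λ / η * ‖y' - y‖ := by
  have hη := S.eta_pos
  set x := lowerSolution g η y with hx
  set x' := lowerSolution g η y' with hx'
  have hv : x' - x ∈ tangent d := S.lowerSolution_sub_mem_tangent y y'
  have k1 := S.inner_grad_lowerSolution y hv
  have k2 := S.inner_grad_lowerSolution y' hv
  rw [← hx, inner_add_right, inner_smul_right] at k1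
  rw [← hx', inner_add_right, inner_smul_right] at k2
  have h1 := S.inner_gradLower_sub_nonneg (S.lowerSolution_mem y) (S.lowerSolution_mem y') y'
  have h2 := norm_sub_sq_le_inner_logVec (S.lowerSolution_mem y) (S.lowerSolution_pos y)
    (S.lowerSolution_mem y') (S.lowerSolution_pos y')
  have h3 := S.norm_gradLower_upper_sub_le (S.lowerSolution_mem y) y y'
  rw [← hx, ← hx', inner_sub_right] at h1
  rw [← hx, ← hx', inner_sub_right] at h2
  rw [← hx] at h3
  have h4 : -(‖x' - x‖ * (Λ * ‖y' - y‖)) ≤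
      inner ℝ (x' - x) (gradLower g x y' - gradLower g x y) := by
    refine (neg_le_neg ?_).trans (neg_abs_le _)
    exact (abs_real_inner_le_norm _ _).trans (by gcongr)
  rw [inner_sub_right] at h4
  have h5 : η * ‖x' - x‖ ^ 2 ≤ ‖x' - x‖ * (Λ * ‖y' - y‖) := by
    have := mul_le_mul_of_nonneg_left h2 hη.le
    linarith
  refine (norm_le_of_mul_sq_le hη (mul_nonneg S.Λ_nonneg (norm_nonneg _)) h5).trans_eq (by ring)

lemma exists_isImplicitDeriv (y : UpperVec m) :
    ∃ R : UpperVec m →L[ℝ] LowerVec d, IsImplicitDeriv g η y R :=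
  exists_variational_solution (tangent d) (regHess g η (lowerSolution g η y) y) S.eta_pos
    (fun _ hv => S.eta_mul_norm_sq_le (S.lowerSolution_mem y) (S.lowerSolution_pos y) y hv) _

lemma norm_implicitDeriv_le {y : UpperVec m} {R : UpperVec m →L[ℝ] LowerVec d}
    (hR : IsImplicitDeriv g η y R) : ‖R‖ ≤ Λ / η := by
  have hη := S.eta_pos
  have hΛ := S.Λ_nonneg
  refine ContinuousLinearMap.opNorm_le_bound _ (by positivity) fun w => ?_
  have h1 := S.eta_mul_norm_sq_le (S.lowerSolution_mem y) (S.lowerSolution_pos y) y (hR.1 w)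
  have h2 := hR.2 w _ (hR.1 w)
  rw [inner_add_right] at h2
  have h3 := abs_le.1 (abs_real_inner_le_norm (R w) (crossDeriv g (lowerSolution g η y) y w))
  have h4 := ContinuousLinearMap.le_of_opNorm_le _
    (S.bounded_cross y _ (S.lowerSolution_mem y)) w
  have h5 := mul_le_mul_of_nonneg_left h4 (norm_nonneg (R w))
  refine (norm_le_of_mul_sq_le (b := Λ * ‖w‖) hη (by positivity) (by linarith)).trans_eq (by ring)

/-- The lower-level solution is differentiable, and its derivative solves the linearized
optimality condition. -/
lemma hasFDerivAt_lowerSolution {y : UpperVec m} {R : UpperVec m →L[ℝ] LowerVec d}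
    (hR : IsImplicitDeriv g η y R) : HasFDerivAt (lowerSolution g η) R y := by
  obtain ⟨ν, hν, hνt⟩ := exists_pos_le_of_mem_trunc d η Ωg
  have hη := S.eta_pos
  have hΛ := S.Λ_nonneg
  have hρ := S.ρh_nonneg
  have hτ := S.τh_nonneg
  have hτy := S.τy_nonneg
  set n : ℝ := (Fintype.card (Σ i : Fin N, Fin (d i)) : ℝ) with hn
  set K : ℝ := (ρh * (Λ / η) ^ 2 + τy + τh * (Λ / η) + η * (n * (ν⁻¹) ^ 2 * (Λ / η) ^ 2)) / η
  have key : ∀ y', ‖lowerSolution g η y' - lowerSolution g η y - R (y' - y)‖ ≤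
      K * ‖y' - y‖ ^ 2 := fun y' => by
    set x := lowerSolution g η y with hx
    set x' := lowerSolution g η y' with hx'
    have hδ : ‖x' - x‖ ≤ Λ / η * ‖y' - y‖ := S.norm_lowerSolution_sub_le y y'
    have hxm : x ∈ simplexProd d := S.lowerSolution_mem y
    have hxm' : x' ∈ simplexProd d := S.lowerSolution_mem y'
    set v := x' - x - R (y' - y) with hv
    have hvt : v ∈ tangent d :=
      (tangent d).sub_mem (S.lowerSolution_sub_mem_tangent y y') (hR.1 _)
    have k1 := S.inner_grad_lowerSolution y hvt
    have k2 := S.inner_grad_lowerSolution y' hvt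
    have k3 := hR.2 (y' - y) v hvt
    rw [← hx] at k1 k3
    rw [← hx'] at k2
    have e1 := S.norm_gradLower_expansion_le hxm hxm' y y'
    have e2 := norm_logVec_sub_sub_le hν (hνt x (S.lowerSolution_mem_trunc y))
      (hνt x' (S.lowerSolution_mem_trunc y'))
    set E1 := gradLower g x' y' - gradLower g x y -
        (hessLower g x y (x' - x) + crossDeriv g x y (y' - y)) with hE1
    set E2 := logVec x' - logVec x - diagOp (fun p => (x p)⁻¹) (x' - x) with hE2
    have e3 : regHess g η x y v = -(E1 + η • E2) -
        (regHess g η x y (R (y' - y)) + crossDeriv g x y (y' - y)) +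
        ((gradLower g x' y' + η • logVec x') - (gradLower g x y + η • logVec x)) := by
      rw [hv, map_sub, regHess_apply, hE1, hE2]
      module
    have h1 := S.eta_mul_norm_sq_le hxm (S.lowerSolution_pos y) y hvt
    rw [e3, inner_add_right, inner_sub_right, inner_sub_right v (gradLower g x' y' + _), k1, k2,
      k3] at h1
    have h2 : ‖-(E1 + η • E2)‖ ≤ (K * η) * ‖y' - y‖ ^ 2 := by
      rw [norm_neg]
      have h3 : ‖x' - x‖ ^ 2 ≤ (Λ / η * ‖y' - y‖) ^ 2 := pow_le_pow_left₀ (norm_nonneg _) hδ 2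
      calc ‖E1 + η • E2‖ ≤ ‖E1‖ + η * ‖E2‖ := by
            refine (norm_add_le _ _).trans_eq ?_
            rw [norm_smul, Real.norm_of_nonneg hη.le]
        _ ≤ (ρh * (Λ / η * ‖y' - y‖) ^ 2 + τy * ‖y' - y‖ ^ 2 +
              τh * (Λ / η * ‖y' - y‖) * ‖y' - y‖) +
              η * (n * (ν⁻¹) ^ 2 * (Λ / η * ‖y' - y‖) ^ 2) := by
            refine add_le_add (e1.trans ?_) (mul_le_mul_of_nonneg_left (e2.trans ?_) hη.le)
            · gcongr
            · gcongr
        _ = _ := by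
            rw [div_mul_cancel₀ _ hη.ne']; ring
    have h4 := (abs_le.1 (abs_real_inner_le_norm v (-(E1 + η • E2)))).2
    have h5 := mul_le_mul_of_nonneg_left h2 (norm_nonneg v)
    have hK : 0 ≤ K * η * ‖y' - y‖ ^ 2 := (norm_nonneg _).trans h2
    refine (norm_le_of_mul_sq_le hη hK (by linarith)).trans_eq ?_
    field_simp
  have hO : HasFDerivAt (fun y' => lowerSolution g η y' - lowerSolution g η y - R (y' - y))
      (0 : UpperVec m →L[ℝ] LowerVec d) y := by
    refine Asymptotics.IsBigO.hasFDerivAt (n := 2) ?_ one_lt_two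
    refine Asymptotics.IsBigO.of_bound K (Filter.Eventually.of_forall fun y' => ?_)
    simpa using key y'
  have h2 : HasFDerivAt (fun y' => R (y' - y)) R y :=
    R.hasFDerivAt.comp y ((hasFDerivAt_id y).sub_const y)
  have h3 := (hO.fun_add h2).add_const (lowerSolution g η y)
  simpa using h3

/-- The derivative of the lower-level solution is Lipschitz. -/
lemma exists_lipschitz_implicitDeriv :
    ∃ K : ℝ, 0 ≤ K ∧ ∀ y y' R R', IsImplicitDeriv g η y R → IsImplicitDeriv g η y' R' →
      ‖R' - R‖ ≤ K * ‖y' - y‖ := by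
  obtain ⟨ν, hν, hνt⟩ := exists_pos_le_of_mem_trunc d η Ωg
  have hη := S.eta_pos
  have hΛ := S.Λ_nonneg
  have hρ := S.ρh_nonneg
  have hρy := S.ρy_nonneg
  have hτ := S.τh_nonneg
  have hτy := S.τy_nonneg
  set KM : ℝ := ρh * (Λ / η) + ρy + η * ((ν⁻¹) ^ 2 * (Λ / η))
  set KC : ℝ := τh * (Λ / η) + τy
  refine ⟨(KM * (Λ / η) + KC) / η, by positivity, fun y y' R R' hR hR' => ?_⟩
  set x := lowerSolution g η y with hx
  set x' := lowerSolution g η y' with hx'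
  have hδ : ‖x' - x‖ ≤ Λ / η * ‖y' - y‖ := S.norm_lowerSolution_sub_le y y'
  have hxm : x ∈ simplexProd d := S.lowerSolution_mem y
  have hxm' : x' ∈ simplexProd d := S.lowerSolution_mem y'
  have hM : ‖regHess g η x' y' - regHess g η x y‖ ≤ KM * ‖y' - y‖ := by
    have h1 := S.lipschitz_hess_lower y x' hxm' x hxm
    have h2 := S.lipschitz_hess_upper x' hxm' y' y
    have h3 := norm_diagOp_inv_sub_le hν (hνt x (S.lowerSolution_mem_trunc y))
      (hνt x' (S.lowerSolution_mem_trunc y'))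
    have e : regHess g η x' y' - regHess g η x y =
        (hessLower g x' y' - hessLower g x' y) + (hessLower g x' y - hessLower g x y) +
        η • (diagOp (fun p => (x' p)⁻¹) - diagOp (fun p => (x p)⁻¹)) := by
      simp only [regHess]; module
    calc _ ≤ ρy * ‖y' - y‖ + ρh * (Λ / η * ‖y' - y‖) +
          η * ((ν⁻¹) ^ 2 * (Λ / η * ‖y' - y‖)) := by
          rw [e]
          refine norm_add₃_le.trans (add_le_add (add_le_add h2 (h1.trans (by gcongr))) ?_)
          rw [norm_smul, Real.norm_of_nonneg hη.le]
          exact mul_le_mul_of_nonneg_left (h3.trans (by gcongr)) hη.le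
      _ = _ := by ring
  have hC : ‖crossDeriv g x' y' - crossDeriv g x y‖ ≤ KC * ‖y' - y‖ := by
    have h1 := S.lipschitz_cross_lower y x' hxm' x hxm
    have h2 := S.lipschitz_cross_upper x' hxm' y' y
    calc _ ≤ τy * ‖y' - y‖ + τh * (Λ / η * ‖y' - y‖) := by
          refine (norm_sub_le_norm_sub_add_norm_sub _ (crossDeriv g x' y) _).trans ?_
          exact add_le_add h2 (h1.trans (by gcongr))
      _ = _ := by ring
  have hRn := S.norm_implicitDeriv_le hR
  refine ContinuousLinearMap.opNorm_le_bound _ (by positivity) fun w => ?_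
  set v := (R' - R) w with hv
  have hvt : v ∈ tangent d := (tangent d).sub_mem (hR'.1 w) (hR.1 w)
  have k1 := hR.2 w v hvt
  have k2 := hR'.2 w v hvt
  rw [← hx] at k1
  rw [← hx'] at k2
  have h1 := S.eta_mul_norm_sq_le hxm' (S.lowerSolution_pos y') y' hvt
  have e3 : regHess g η x' y' v = (regHess g η x' y' (R' w) + crossDeriv g x' y' w) -
      (regHess g η x y (R w) + crossDeriv g x y w) -
      ((regHess g η x' y' - regHess g η x y) (R w) +
        (crossDeriv g x' y' - crossDeriv g x y) w) := by
    simp only [hv, _root_.sub_apply, map_sub]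
    abel
  rw [e3, inner_sub_right, inner_sub_right, k1, k2] at h1
  set z := (regHess g η x' y' - regHess g η x y) (R w) +
        (crossDeriv g x' y' - crossDeriv g x y) w with hz
  have hzn : ‖z‖ ≤ (KM * (Λ / η) + KC) * ‖y' - y‖ * ‖w‖ := by
    have h2 := ContinuousLinearMap.le_of_opNorm_le _ hM (R w)
    have h3 := ContinuousLinearMap.le_of_opNorm_le _ hC w
    have h4 := ContinuousLinearMap.le_of_opNorm_le _ hRn w
    calc ‖z‖ ≤ KM * ‖y' - y‖ * (Λ / η * ‖w‖) + KC * ‖y' - y‖ * ‖w‖ :=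
          (norm_add_le _ _).trans (add_le_add (h2.trans (by gcongr)) h3)
      _ = _ := by ring
  have h5 := (abs_le.1 (abs_real_inner_le_norm v z)).1
  have h6 := mul_le_mul_of_nonneg_left hzn (norm_nonneg v)
  refine (norm_le_of_mul_sq_le hη ((norm_nonneg _).trans hzn) (by linarith)).trans_eq ?_
  ring

end RegularLower

end

section

variable {N : ℕ} {d : Fin N → ℕ} {m : ℕ}

/-! ### The hypergradient -/

/-- The hypergradient `∇_y f(h, y) + Rᵀ ∇_h f(h, y)`: the gradient of `y ↦ f(h(y), y)` for a map
`h` with value `h` and Jacobian `R` at `y`. -/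
def hypergradient (f : LowerVec d → UpperVec m → ℝ) (h : LowerVec d) (y : UpperVec m)
    (R : UpperVec m →L[ℝ] LowerVec d) : UpperVec m :=
  gradUpper f h y + ContinuousLinearMap.adjoint R (gradLower f h y)

variable {f : LowerVec d → UpperVec m → ℝ}

lemma hasFDerivAt_joint {h : LowerVec d} {y : UpperVec m}
    (hf : DifferentiableAt ℝ (joint f) (WithLp.toLp 2 (h, y))) {h' : UpperVec m → LowerVec d}
    {R : UpperVec m →L[ℝ] LowerVec d} (hh : h' y = h) (hR : HasFDerivAt h' R y) :
    HasFDerivAt (fun y' => f (h' y') y') ((InnerProductSpace.toDual ℝ (UpperVec m))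
      ((gradient (joint f) (WithLp.toLp 2 (h, y))).snd +
        ContinuousLinearMap.adjoint R (gradient (joint f) (WithLp.toLp 2 (h, y))).fst)) y := by
  subst hh
  have h1 := hf.hasGradientAt.hasFDerivAt
  have h2 : HasFDerivAt (fun y' => WithLp.toLp 2 (h' y', y'))
      ((WithLp.prodContinuousLinearEquiv 2 ℝ (LowerVec d)
        (UpperVec m)).symm.toContinuousLinearMap ∘L
        (R.prod (ContinuousLinearMap.id ℝ (UpperVec m)))) y :=
    (WithLp.prodContinuousLinearEquiv 2 ℝ (LowerVec d)
      (UpperVec m)).symm.hasFDerivAt.comp y (hR.prodMk (hasFDerivAt_id y))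
  generalize gradient (joint f) (WithLp.toLp 2 (h' y, y)) = G at h1 ⊢
  refine (h1.comp y h2).congr_fderiv ?_
  ext w
  simp [WithLp.prod_inner_apply, ContinuousLinearMap.adjoint_inner_left]
  ring

lemma gradUpper_eq_snd {h : LowerVec d} {y : UpperVec m}
    (hf : DifferentiableAt ℝ (joint f) (WithLp.toLp 2 (h, y))) :
    gradUpper f h y = (gradient (joint f) (WithLp.toLp 2 (h, y))).snd := by
  have h1 := hasFDerivAt_joint hf (h' := fun _ => h) rfl (hasFDerivAt_const h y)
  rw [map_zero, _root_.zero_apply, add_zero] at h1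
  exact HasGradientAt.gradient h1

lemma gradLower_eq_fst {h : LowerVec d} {y : UpperVec m}
    (hf : DifferentiableAt ℝ (joint f) (WithLp.toLp 2 (h, y))) :
    gradLower f h y = (gradient (joint f) (WithLp.toLp 2 (h, y))).fst := by
  refine HasGradientAt.gradient ?_
  have h1 := hf.hasGradientAt.hasFDerivAt
  have h2 : HasFDerivAt (fun h' => WithLp.toLp 2 (h', y))
      ((WithLp.prodContinuousLinearEquiv 2 ℝ (LowerVec d)
        (UpperVec m)).symm.toContinuousLinearMap ∘L
        ((ContinuousLinearMap.id ℝ (LowerVec d)).prod 0)) h :=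
    (WithLp.prodContinuousLinearEquiv 2 ℝ (LowerVec d)
      (UpperVec m)).symm.hasFDerivAt.comp h ((hasFDerivAt_id h).prodMk (hasFDerivAt_const y h))
  rw [hasGradientAt_iff_hasFDerivAt]
  generalize gradient (joint f) (WithLp.toLp 2 (h, y)) = G at h1 ⊢
  refine (h1.comp h h2).congr_fderiv ?_
  ext w
  simp [WithLp.prod_inner_apply]

lemma norm_fst_le (z : WithLp 2 (LowerVec d × UpperVec m)) : ‖z.fst‖ ≤ ‖z‖ := by
  refine abs_le_of_sq_le_sq' ?_ (norm_nonneg _) |>.2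
  rw [WithLp.prod_norm_sq_eq_of_L2]
  exact le_add_of_nonneg_right (sq_nonneg _)

lemma norm_snd_le (z : WithLp 2 (LowerVec d × UpperVec m)) : ‖z.snd‖ ≤ ‖z‖ := by
  refine abs_le_of_sq_le_sq' ?_ (norm_nonneg _) |>.2
  rw [WithLp.prod_norm_sq_eq_of_L2]
  exact le_add_of_nonneg_left (sq_nonneg _)

lemma norm_toLp_le (h : LowerVec d) (y : UpperVec m) :
    ‖(WithLp.toLp 2 (h, y) : WithLp 2 (LowerVec d × UpperVec m))‖ ≤ ‖h‖ + ‖y‖ := by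
  refine abs_le_of_sq_le_sq' ?_ (by positivity) |>.2
  rw [WithLp.prod_norm_sq_eq_of_L2]
  change ‖h‖ ^ 2 + ‖y‖ ^ 2 ≤ _
  nlinarith [norm_nonneg h, norm_nonneg y]

variable {Lf Ωf : ℝ}

lemma norm_hypergradient_sub_le (hf : UpperAssumptions f Lf Ωf) (hLf : 0 ≤ Lf)
    {h h' : LowerVec d} (hh : h ∈ simplexProd d) (hh' : h' ∈ simplexProd d) (y y' : UpperVec m)
    (R R' : UpperVec m →L[ℝ] LowerVec d) :
    ‖hypergradient f h' y' R' - hypergradient f h y R‖ ≤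
      (1 + ‖R‖) * (Lf * (‖h' - h‖ + ‖y' - y‖)) + ‖R' - R‖ * Ωf := by
  have hd := hf.differentiable h hh y
  have hd' := hf.differentiable h' hh' y'
  have hlip : ‖gradient (joint f) (WithLp.toLp 2 (h', y')) -
      gradient (joint f) (WithLp.toLp 2 (h, y))‖ ≤ Lf * (‖h' - h‖ + ‖y' - y‖) := by
    refine (hf.lipschitz_grad h' hh' h hh y' y).trans (mul_le_mul_of_nonneg_left ?_ hLf)
    rw [← WithLp.toLp_sub, Prod.mk_sub_mk]
    exact norm_toLp_le _ _
  have h1 : ‖gradUpper f h' y' - gradUpper f h y‖ ≤ Lf * (‖h' - h‖ + ‖y' - y‖) := by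
    rw [gradUpper_eq_snd hd, gradUpper_eq_snd hd', ← WithLp.sub_snd]
    exact (norm_snd_le _).trans hlip
  have h2 : ‖gradLower f h' y' - gradLower f h y‖ ≤ Lf * (‖h' - h‖ + ‖y' - y‖) := by
    rw [gradLower_eq_fst hd, gradLower_eq_fst hd', ← WithLp.sub_fst]
    exact (norm_fst_le _).trans hlip
  have h3 : ‖gradLower f h' y'‖ ≤ Ωf := by
    rw [gradLower_eq_fst hd']
    exact (norm_fst_le _).trans (hf.bounded_grad h' hh' y')
  have e : hypergradient f h' y' R' - hypergradient f h y R =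
      (gradUpper f h' y' - gradUpper f h y) +
      ContinuousLinearMap.adjoint R (gradLower f h' y' - gradLower f h y) +
      ContinuousLinearMap.adjoint (R' - R) (gradLower f h' y') := by
    simp only [hypergradient, map_sub, _root_.sub_apply]
    abel
  rw [e]
  have h4 : ‖ContinuousLinearMap.adjoint R (gradLower f h' y' - gradLower f h y)‖ ≤
      ‖R‖ * (Lf * (‖h' - h‖ + ‖y' - y‖)) := by
    refine (ContinuousLinearMap.le_opNorm _ _).trans ?_
    rw [LinearIsometryEquiv.norm_map]
    gcongr
  have h5 : ‖ContinuousLinearMap.adjoint (R' - R) (gradLower f h' y')‖ ≤ ‖R' - R‖ * Ωf := by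
    refine (ContinuousLinearMap.le_opNorm _ _).trans ?_
    rw [LinearIsometryEquiv.norm_map]
    gcongr
  refine (norm_add₃_le.trans (add_le_add (add_le_add h1 h4) h5)).trans_eq (by ring)

variable {g : LowerVec d → UpperVec m → ℝ} {η Lg Ωg τh ρh Λ τy ρy : ℝ}

namespace RegularLower

variable (S : RegularLower g η Lg Ωg τh ρh Λ τy ρy)
include S

lemma hasGradientAt_bilevelObj (hf : UpperAssumptions f Lf Ωf) {y : UpperVec m}
    {R : UpperVec m →L[ℝ] LowerVec d} (hR : IsImplicitDeriv g η y R) :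
    HasGradientAt (bilevelObj f g η) (hypergradient f (lowerSolution g η y) y R) y := by
  have hd := hf.differentiable _ (S.lowerSolution_mem y) y
  rw [hypergradient, gradUpper_eq_snd hd, gradLower_eq_fst hd]
  exact hasFDerivAt_joint hd rfl (S.hasFDerivAt_lowerSolution hR)

lemma differentiable_bilevelObj (hf : UpperAssumptions f Lf Ωf) :
    Differentiable ℝ (bilevelObj f g η) := fun y => by
  obtain ⟨R, hR⟩ := S.exists_isImplicitDeriv y
  exact (S.hasGradientAt_bilevelObj hf hR).hasFDerivAt.differentiableAt

/-- The bilevel objective has a Lipschitz gradient. -/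
lemma exists_lipschitz_gradient_bilevelObj (hf : UpperAssumptions f Lf Ωf) (hLf : 0 ≤ Lf)
    (hΩf : 0 ≤ Ωf) :
    ∃ L : ℝ, 0 < L ∧ ∀ y y', ‖gradient (bilevelObj f g η) y' - gradient (bilevelObj f g η) y‖ ≤
      L * ‖y' - y‖ := by
  obtain ⟨K, hK, hKR⟩ := S.exists_lipschitz_implicitDeriv
  have hη := S.eta_pos
  have hΛ := S.Λ_nonneg
  refine ⟨(1 + Λ / η) * (Lf * (Λ / η + 1)) + K * Ωf + 1, by positivity, fun y y' => ?_⟩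
  obtain ⟨R, hR⟩ := S.exists_isImplicitDeriv y
  obtain ⟨R', hR'⟩ := S.exists_isImplicitDeriv y'
  rw [(S.hasGradientAt_bilevelObj hf hR).gradient, (S.hasGradientAt_bilevelObj hf hR').gradient]
  have h1 := norm_hypergradient_sub_le hf hLf (S.lowerSolution_mem y) (S.lowerSolution_mem y')
    y y' R R'
  have h2 := S.norm_lowerSolution_sub_le y y'
  have h3 := S.norm_implicitDeriv_le hR
  have h4 := hKR y y' R R' hR hR'
  calc _ ≤ (1 + Λ / η) * (Lf * (Λ / η * ‖y' - y‖ + ‖y' - y‖)) + K * ‖y' - y‖ * Ωf :=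
        h1.trans (by gcongr)
    _ ≤ _ := by nlinarith [norm_nonneg (y' - y)]

end RegularLower

/-! ### Inexact gradient descent -/

/-- One step of gradient descent with an inexact gradient. -/
lemma inexact_descent {F : UpperVec m → ℝ} (hF : Differentiable ℝ F) {L : ℝ} (hL : 0 < L)
    (hlip : ∀ y y', ‖gradient F y' - gradient F y‖ ≤ L * ‖y' - y‖) {β e : ℝ} (hβ : 0 < β)
    (hβL : β ≤ 1 / (2 * L)) (y v : UpperVec m) (hv : ‖v - gradient F y‖ ≤ e) :
    β / 2 * ‖gradient F y‖ ^ 2 ≤ F y - F (y - β • v) + β / 2 * e ^ 2 := by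
  have h1 := descent_inequality convex_univ hL.le
    (fun x _ => (hF x).hasGradientAt) (fun x _ x' _ => hlip x' x) (Set.mem_univ y)
    (Set.mem_univ (y - β • v))
  have e0 : y - β • v - y = -(β • v) := by abel
  rw [e0, inner_neg_right, inner_smul_right, norm_neg, norm_smul, Real.norm_of_nonneg hβ.le] at h1
  -- polarization: `2 ⟪a, v⟫ = ‖a‖² + ‖v‖² - ‖v - a‖²`
  have h2 := norm_sub_sq_real v (gradient F y)
  rw [real_inner_comm] at h2
  have h3 : ‖v - gradient F y‖ ^ 2 ≤ e ^ 2 := pow_le_pow_left₀ (norm_nonneg _) hv 2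
  have h4 : L * (β * ‖v‖) ^ 2 ≤ β / 2 * ‖v‖ ^ 2 := by
    have h5 : β * L ≤ 1 / 2 := by
      calc β * L ≤ 1 / (2 * L) * L := by gcongr
        _ = 1 / 2 := by field_simp
    have h6 : L * (β * ‖v‖) ^ 2 = (β * L) * (β * ‖v‖ ^ 2) := by ring
    rw [h6]
    calc (β * L) * (β * ‖v‖ ^ 2) ≤ 1 / 2 * (β * ‖v‖ ^ 2) := by gcongr
      _ = _ := by ring
  have h7 : β / 2 * ‖v - gradient F y‖ ^ 2 ≤ β / 2 * e ^ 2 := by gcongr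
  have h8 : β / 2 * ‖v - gradient F y‖ ^ 2 = β / 2 * (‖v‖ ^ 2 + ‖gradient F y‖ ^ 2) -
      β * inner ℝ (gradient F y) v := by
    rw [h2]; ring
  linarith

/-- Gradient descent with gradient errors at most `e`, summed over the iterations. -/
lemma average_norm_gradient_sq_le {F : UpperVec m → ℝ} (hF : Differentiable ℝ F) {L : ℝ}
    (hL : 0 < L) (hlip : ∀ y y', ‖gradient F y' - gradient F y‖ ≤ L * ‖y' - y‖) {b : ℝ}
    (hb : ∀ y, b ≤ F y) {β β₀ e : ℝ} (hβ₀ : 0 < β₀) (hβ : β₀ ≤ β) (hβL : β ≤ 1 / (2 * L))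
    {y v : ℕ → UpperVec m} (hy : ∀ k, y (k + 1) = y k - β • v k)
    (hv : ∀ k, ‖v k - gradient F (y k)‖ ≤ e) {K : ℕ} (hK : 1 ≤ K) :
    1 / (K : ℝ) * ∑ k ∈ Finset.range K, ‖gradient F (y k)‖ ^ 2 ≤
      2 * (F (y 0) - b) / β₀ / K + e ^ 2 := by
  have hβ0 : 0 < β := hβ₀.trans_le hβ
  have h1 : ∀ k, β / 2 * ‖gradient F (y k)‖ ^ 2 ≤ F (y k) - F (y (k + 1)) + β / 2 * e ^ 2 :=
    fun k => by
      rw [hy k]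
      exact inexact_descent hF hL hlip hβ0 hβL (y k) (v k) (hv k)
  have h2 := Finset.sum_le_sum fun k (_ : k ∈ Finset.range K) => h1 k
  rw [← Finset.mul_sum, Finset.sum_add_distrib, Finset.sum_range_sub'] at h2
  simp only [Finset.sum_const, Finset.card_range, nsmul_eq_mul] at h2
  have hK0 : (0 : ℝ) < K := by exact_mod_cast hK
  have h3 : ∑ k ∈ Finset.range K, ‖gradient F (y k)‖ ^ 2 ≤
      2 * (F (y 0) - b) / β + K * e ^ 2 := by
    rw [← mul_le_mul_iff_right₀ (by positivity : 0 < β / 2)]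
    have h4 : β / 2 * (2 * (F (y 0) - b) / β + K * e ^ 2) =
        F (y 0) - b + K * (β / 2 * e ^ 2) := by field_simp
    rw [h4]
    have := hb (y K)
    linarith
  have h5 : 2 * (F (y 0) - b) / β ≤ 2 * (F (y 0) - b) / β₀ := by
    have := hb (y 0)
    exact div_le_div_of_nonneg_left (by linarith) hβ₀ hβ
  calc _ ≤ 1 / (K : ℝ) * (2 * (F (y 0) - b) / β₀ + K * e ^ 2) := by gcongr; linarith
    _ = _ := by field_simp

end

section

variable {N : ℕ} {d : Fin N → ℕ} {m : ℕ}

/-! ### Perturbed geometric recursions -/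

/-- A recursion `a (t + 1) ≤ (r + Q q ^ t) a t + Q q ^ t` with `r, q < 1` decays geometrically, at
a rate and with a constant that depend only on `r`, `q`, `Q` and a bound on `a 0`. -/
lemma exists_geometric_bound {r q Q : ℝ} (hr : 0 ≤ r) (hr1 : r < 1) (hq : 0 ≤ q) (hq1 : q < 1)
    (hQ : 0 ≤ Q) {a₀ : ℝ} (ha₀ : 0 ≤ a₀) :
    ∃ lam M : ℝ, 0 < lam ∧ lam < 1 ∧ q ≤ lam ∧ 0 ≤ M ∧ ∀ a : ℕ → ℝ, a 0 ≤ a₀ →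
      (∀ t, a (t + 1) ≤ (r + Q * q ^ t) * a t + Q * q ^ t) → ∀ t, a t ≤ M * lam ^ t := by
  obtain ⟨lam, hlam, hlam1⟩ := exists_between (max_lt hr1 hq1)
  have hrl : r < lam := (le_max_left _ _).trans_lt hlam
  have hql : q < lam := (le_max_right _ _).trans_lt hlam
  have hl0 : 0 < lam := hr.trans_lt hrl
  -- the extremal sequence, for which the recursion holds with equality
  let b : ℕ → ℝ := fun t => Nat.rec a₀ (fun s x => (r + Q * q ^ s) * x + Q * q ^ s) t
  have hb1 : ∀ t, b (t + 1) = (r + Q * q ^ t) * b t + Q * q ^ t := fun t => rfl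
  have hb : ∀ t, 0 ≤ b t := fun t => by
    induction t with
    | zero => exact ha₀
    | succ t ih => rw [hb1]; positivity
  obtain ⟨t₀, ht₀⟩ : ∃ t₀ : ℕ, ∀ t ≥ t₀, Q * q ^ t ≤ (lam - r) / 2 := by
    have h1 : Filter.Tendsto (fun t : ℕ => Q * q ^ t) Filter.atTop (𝓝 0) := by
      simpa using (tendsto_pow_atTop_nhds_zero_of_lt_one hq hq1).const_mul Q
    exact Filter.eventually_atTop.1 (h1.eventually_le_const (by linarith))
  set M : ℝ := ∑ s ∈ Finset.range (t₀ + 1), b s / lam ^ s + 2 * Q / (lam - r) with hM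
  have hlr : 0 < lam - r := by linarith
  have hs0 : ∀ s ∈ Finset.range (t₀ + 1), 0 ≤ b s / lam ^ s := fun s _ =>
    div_nonneg (hb s) (by positivity)
  have hQ0 : 0 ≤ 2 * Q / (lam - r) := by positivity
  have hM0 : 0 ≤ M := add_nonneg (Finset.sum_nonneg hs0) hQ0
  have hMQ : Q ≤ (lam - r) / 2 * M := by
    have : 2 * Q / (lam - r) ≤ M := le_add_of_nonneg_left (Finset.sum_nonneg hs0)
    rw [div_le_iff₀ hlr] at this
    linarith
  have hbM : ∀ t, b t ≤ M * lam ^ t := fun t => by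
    rcases le_total t t₀ with h | h
    · rw [← div_le_iff₀ (by positivity)]
      exact (Finset.single_le_sum hs0 (Finset.mem_range.2 (by omega))).trans
        (le_add_of_nonneg_right hQ0)
    · induction t, h using Nat.le_induction with
      | base =>
        rw [← div_le_iff₀ (by positivity)]
        exact (Finset.single_le_sum hs0 (Finset.mem_range.2 (by omega))).trans
          (le_add_of_nonneg_right hQ0)
      | succ t ht ih =>
        rw [hb1]
        have h0 := hb t
        have h1 := ht₀ t ht
        have h2 : q ^ t ≤ lam ^ t := pow_le_pow_left₀ hq hql.le t
        calc (r + Q * q ^ t) * b t + Q * q ^ t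
            ≤ (r + (lam - r) / 2) * (M * lam ^ t) + ((lam - r) / 2 * M) * lam ^ t := by gcongr
          _ = M * lam ^ (t + 1) := by ring
  refine ⟨lam, M, hl0, hlam1, hql.le, hM0, fun a ha0 ha t => le_trans ?_ (hbM t)⟩
  induction t with
  | zero => exact ha0
  | succ t ih =>
    refine (ha t).trans ?_
    rw [hb1]
    gcongr

/-! ### The weighted norm `v ↦ ‖v / √x‖` -/

lemma norm_diagOp_inv_sqrt_le {x : LowerVec d} {ν : ℝ} (hν : 0 < ν) (hx : ∀ p, ν ≤ x p) :
    ‖diagOp (fun p => (√(x p))⁻¹)‖ ≤ (√ν)⁻¹ := by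
  refine norm_diagOp_le (by positivity) fun p => ?_
  rw [abs_of_nonneg (by positivity)]
  exact inv_anti₀ (Real.sqrt_pos.2 hν) (Real.sqrt_le_sqrt (hx p))

lemma norm_le_norm_diagOp_inv_sqrt_comp {x : LowerVec d} (hx : x ∈ simplexProd d)
    (hpos : ∀ p, 0 < x p) (R : UpperVec m →L[ℝ] LowerVec d) :
    ‖R‖ ≤ ‖diagOp (fun p => (√(x p))⁻¹) ∘L R‖ := by
  refine ContinuousLinearMap.opNorm_le_bound _ (norm_nonneg _) fun w => le_trans ?_
    (ContinuousLinearMap.le_opNorm _ w)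
  refine abs_le_of_sq_le_sq' ?_ (norm_nonneg _) |>.2
  rw [norm_sq_eq_sum, norm_sq_eq_sum]
  refine Finset.sum_le_sum fun p _ => ?_
  rw [ContinuousLinearMap.comp_apply, diagOp_apply, mul_pow]
  refine le_mul_of_one_le_left (sq_nonneg _) (one_le_pow₀ ?_)
  exact (one_le_inv₀ (Real.sqrt_pos.2 (hpos p))).2 (Real.sqrt_le_one.2 (le_one_of_mem hx p))

/-! ### The derivatives of the mirror descent step -/

lemma hasFDerivAt_logVec {h : LowerVec d} (hpos : ∀ p, 0 < h p) :
    HasFDerivAt (logVec (d := d)) (diagOp fun p => (h p)⁻¹) h := by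
  rw [← hasFDerivWithinAt_univ, hasFDerivWithinAt_euclidean]
  intro p
  rw [hasFDerivWithinAt_univ]
  exact ((EuclideanSpace.proj p : LowerVec d →L[ℝ] ℝ).hasFDerivAt (x := h)).log (hpos p).ne'

variable {g : LowerVec d → UpperVec m → ℝ} {η Lg Ωg τh ρh Λ τy ρy : ℝ}

/-- The derivative in `h` of the logarithm `log h - α ∇_h g^η(h, y)` of the unnormalized mirror
descent step. -/
def logStepDeriv (g : LowerVec d → UpperVec m → ℝ) (η α : ℝ) (h : LowerVec d) (y : UpperVec m) :
    LowerVec d →L[ℝ] LowerVec d :=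
  diagOp (fun p => (h p)⁻¹) - α • regHess g η h y

lemma logStepDeriv_apply (α : ℝ) (h : LowerVec d) (y : UpperVec m) (v : LowerVec d) :
    logStepDeriv g η α h y v = diagOp (fun p => (h p)⁻¹) v - α • regHess g η h y v := rfl

lemma logStepDeriv_eq (α : ℝ) (h : LowerVec d) (y : UpperVec m) (v : LowerVec d) :
    logStepDeriv g η α h y v =
      (1 - α * η) • diagOp (fun p => (h p)⁻¹) v - α • hessLower g h y v := by
  rw [logStepDeriv_apply, regHess_apply]
  module

namespace RegularLower

variable (S : RegularLower g η Lg Ωg τh ρh Λ τy ρy)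
include S

lemma hasFDerivAt_mirrorStep_lower {h : LowerVec d} (hh : h ∈ simplexProd d)
    (hpos : ∀ p, 0 < h p) (α : ℝ) (y : UpperVec m) :
    HasFDerivAt (fun h' => mirrorStep g η α h' y)
      (softmaxJac (mirrorStep g η α h y) ∘L logStepDeriv g η α h y) h := by
  have hev : (fun h' => mirrorStep g η α h' y) =ᶠ[𝓝 h]
      fun h' => softmax (logVec h' - α • (gradLower g h' y + η • logVec h')) := by
    have h1 : ∀ᶠ h' : LowerVec d in 𝓝 h, ∀ p, 0 < h' p := Filter.eventually_all.2 fun p =>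
      (EuclideanSpace.proj p : LowerVec d →L[ℝ] ℝ).continuous.continuousAt.eventually_const_lt
        (hpos p)
    filter_upwards [h1, S.differentiable h hh y] with h' hp' hd'
    rw [mirrorStep_eq_softmax hp', gradLower_regObj hp' hd']
  refine HasFDerivAt.congr_of_eventuallyEq ?_ hev
  have hl := hasFDerivAt_logVec hpos
  have h2 : HasFDerivAt (fun h' => logVec h' - α • (gradLower g h' y + η • logVec h'))
      (logStepDeriv g η α h y) h :=
    hl.sub (((S.hasFDerivAt_gradLower hh y).add (hl.const_smul η)).const_smul α)
  have h3 := hev.self_of_nhds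
  dsimp only at h3
  rw [h3]
  exact (hasFDerivAt_softmax _).comp h h2

lemma hasFDerivAt_mirrorStep_upper {h : LowerVec d} (hh : h ∈ simplexProd d)
    (hpos : ∀ p, 0 < h p) (α : ℝ) (y : UpperVec m) :
    HasFDerivAt (fun y' => mirrorStep g η α h y')
      (softmaxJac (mirrorStep g η α h y) ∘L (-(α • crossDeriv g h y))) y := by
  have heq : (fun y' => mirrorStep g η α h y') =
      fun y' => softmax (logVec h - α • (gradLower g h y' + η • logVec h)) := by
    funext y'
    rw [mirrorStep_eq_softmax hpos,
      gradLower_regObj hpos (S.differentiable h hh y').self_of_nhds]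
  have h3 := congrFun heq y
  rw [heq, h3]
  have h2 : HasFDerivAt (fun y' => logVec h - α • (gradLower g h y' + η • logVec h))
      (-(α • crossDeriv g h y)) y :=
    (((S.hasFDerivAt_gradLower_upper hh y).add_const _).const_smul α).const_sub _
  exact (hasFDerivAt_softmax _).comp y h2

lemma jacobianStep_eq {h : LowerVec d} (hh : h ∈ simplexProd d) (hpos : ∀ p, 0 < h p) (α : ℝ)
    (y : UpperVec m) (R : UpperVec m →L[ℝ] LowerVec d) :
    jacobianStep g η α R h y = softmaxJac (mirrorStep g η α h y) ∘L
      (logStepDeriv g η α h y ∘L R - α • crossDeriv g h y) := by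
  rw [jacobianStep, (S.hasFDerivAt_mirrorStep_lower hh hpos α y).fderiv,
    (S.hasFDerivAt_mirrorStep_upper hh hpos α y).fderiv, sub_eq_add_neg,
    ContinuousLinearMap.comp_add, ContinuousLinearMap.comp_assoc]

lemma jacobianStep_mem_tangent {h : LowerVec d} (hh : h ∈ simplexProd d) (hpos : ∀ p, 0 < h p)
    (α : ℝ) (y : UpperVec m) (R : UpperVec m →L[ℝ] LowerVec d) (w : UpperVec m) :
    jacobianStep g η α R h y w ∈ tangent d := by
  rw [S.jacobianStep_eq hh hpos]
  exact softmaxJac_mem_tangent (S.mirrorStep_mem hpos α y) _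

/-- The derivative of the lower-level solution is a fixed point of iterative differentiation. -/
lemma implicitDeriv_fixedPoint {y : UpperVec m} {R : UpperVec m →L[ℝ] LowerVec d}
    (hR : IsImplicitDeriv g η y R) (α : ℝ) :
    softmaxJac (lowerSolution g η y) ∘L (logStepDeriv g η α (lowerSolution g η y) y ∘L R -
      α • crossDeriv g (lowerSolution g η y) y) = R := by
  set x := lowerSolution g η y with hx
  have hxm : x ∈ simplexProd d := S.lowerSolution_mem y
  ext1 w
  obtain ⟨c, hc⟩ := exists_blockConst_of_orthogonal S.dim_pos (hR.2 w)
  have h1 := softmaxJac_blockConst hxm c hc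
  have h2 := softmaxJac_diagOp_inv (S.lowerSolution_pos y) (hR.1 w)
  have e : (logStepDeriv g η α x y ∘L R - α • crossDeriv g x y) w =
      diagOp (fun p => (x p)⁻¹) (R w) - α • (regHess g η x y (R w) + crossDeriv g x y w) := by
    change logStepDeriv g η α x y (R w) - α • crossDeriv g x y w = _
    rw [logStepDeriv_apply]
    module
  rw [ContinuousLinearMap.comp_apply, e, map_sub, map_smul, h2, h1, smul_zero, sub_zero]

/-- At the solution `x`, the derivative of the mirror descent step is a contraction of the tangent
space in the norm `v ↦ ‖v / √x‖`. It is self-adjoint in the corresponding inner product, with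
spectrum in `[0, 1 - α η]`, which enters through the nonnegativity of its quadratic form at
`v - a / (1 - α η)`, where `a` is the image of `v`. -/
lemma norm_softmaxJac_logStepDeriv_le {x : LowerVec d} (hxm : x ∈ simplexProd d)
    (hpos : ∀ p, 0 < x p) {α : ℝ} (hα : 0 ≤ α) (hα' : α * (4 * Lg + η) ≤ 1)
    (hαη : α * η < 1) (y : UpperVec m) {v : LowerVec d} (hv : v ∈ tangent d) :
    ‖diagOp (fun p => (√(x p))⁻¹) (softmaxJac x (logStepDeriv g η α x y v))‖ ≤
      (1 - α * η) * ‖diagOp (fun p => (√(x p))⁻¹) v‖ := by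
  set r := 1 - α * η with hr
  have hr0 : 0 < r := by rw [hr]; linarith
  set a := softmaxJac x (logStepDeriv g η α x y v) with ha
  have hat : a ∈ tangent d := softmaxJac_mem_tangent hxm _
  have hq : ∀ u : LowerVec d, ‖diagOp (fun p => (√(x p))⁻¹) u‖ ^ 2 =
      inner ℝ u (diagOp (fun p => (x p)⁻¹) u) := fun u => by
    rw [norm_sq_eq_sum, inner_eq_sum]
    refine Finset.sum_congr rfl fun p _ => ?_
    rw [diagOp_apply, diagOp_apply, mul_pow, inv_pow, Real.sq_sqrt (hpos p).le]
    ring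
  have hqn : ∀ u : LowerVec d, ‖u‖ ^ 2 ≤ inner ℝ u (diagOp (fun p => (x p)⁻¹) u) := fun u => by
    rw [norm_sq_eq_sum, inner_eq_sum]
    refine Finset.sum_le_sum fun p _ => ?_
    have h3 : 1 ≤ (x p)⁻¹ := (one_le_inv₀ (hpos p)).2 (le_one_of_mem hxm p)
    rw [diagOp_apply]
    nlinarith [sq_nonneg (u p)]
  -- the weighted square of `a` is `b(a, v)`, for the symmetric form `b(u, w) = ⟪u, logStepDeriv w⟫`
  have hqa : inner ℝ a (diagOp (fun p => (x p)⁻¹) a) = inner ℝ a (logStepDeriv g η α x y v) :=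
    inner_diagOp_inv_softmaxJac hpos hat _
  have hsymm : inner ℝ v (logStepDeriv g η α x y a) = inner ℝ a (logStepDeriv g η α x y v) := by
    simp only [logStepDeriv_eq, inner_sub_right, inner_smul_right]
    rw [inner_diagOp_comm, S.inner_hessLower_comm hxm y v a]
  have hle : ∀ u ∈ tangent d, inner ℝ u (logStepDeriv g η α x y u) ≤
      r * inner ℝ u (diagOp (fun p => (x p)⁻¹) u) := fun u hu => by
    simp only [logStepDeriv_eq, inner_sub_right, inner_smul_right]
    have := mul_nonneg hα (S.inner_hessLower_nonneg hxm hpos y hu)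
    linarith
  have hge : ∀ u : LowerVec d, 0 ≤ inner ℝ u (logStepDeriv g η α x y u) := fun u => by
    simp only [logStepDeriv_eq, inner_sub_right, inner_smul_right]
    have h1 : inner ℝ u (hessLower g x y u) ≤ Lg * ‖u‖ ^ 2 := by
      refine (real_inner_le_norm _ _).trans ?_
      have := ContinuousLinearMap.le_of_opNorm_le _ (S.bounded_hess y x hxm) u
      nlinarith [norm_nonneg u]
    have h2 := mul_le_mul_of_nonneg_left h1 hα
    have h3 : α * Lg ≤ r := by
      have := mul_nonneg hα S.Lg_nonneg
      rw [hr]; linarith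
    have h4 := mul_le_mul h3 (hqn u) (sq_nonneg _) hr0.le
    linarith
  have h0 := hge (v - r⁻¹ • a)
  have hexp : inner ℝ (v - r⁻¹ • a) (logStepDeriv g η α x y (v - r⁻¹ • a)) =
      inner ℝ v (logStepDeriv g η α x y v) - 2 * r⁻¹ * inner ℝ a (logStepDeriv g η α x y v) +
        r⁻¹ ^ 2 * inner ℝ a (logStepDeriv g η α x y a) := by
    simp only [map_sub, map_smul, inner_sub_left, inner_sub_right, inner_smul_left,
      inner_smul_right, hsymm, conj_trivial]
    ring
  rw [hexp, ← hqa] at h0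
  have h1 := hle v hv
  have h2 := mul_le_mul_of_nonneg_left (hle a hat) (sq_nonneg r⁻¹)
  refine abs_le_of_sq_le_sq' ?_ (by positivity) |>.2
  rw [mul_pow, hq, hq]
  set qa := inner ℝ a (diagOp (fun p => (x p)⁻¹) a)
  set qv := inner ℝ v (diagOp (fun p => (x p)⁻¹) v)
  have h3 : r⁻¹ ^ 2 * (r * qa) = r⁻¹ * qa := by field_simp
  have h4 : r⁻¹ * qa ≤ r * qv := by linarith
  rw [inv_mul_le_iff₀ hr0] at h4
  linarith

lemma norm_regHess_le {h : LowerVec d} (hh : h ∈ simplexProd d) {ν : ℝ} (hν : 0 < ν)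
    (hνh : ∀ p, ν ≤ h p) (y : UpperVec m) : ‖regHess g η h y‖ ≤ Lg + η * ν⁻¹ := by
  refine (norm_add_le _ _).trans (add_le_add (S.bounded_hess y h hh) ?_)
  rw [norm_smul, Real.norm_of_nonneg S.eta_pos.le]
  exact mul_le_mul_of_nonneg_left (norm_diagOp_inv_le hν hνh) S.eta_pos.le

lemma norm_logStepDeriv_le {h : LowerVec d} (hh : h ∈ simplexProd d) {ν : ℝ} (hν : 0 < ν)
    (hνh : ∀ p, ν ≤ h p) {α : ℝ} (hα : 0 ≤ α) (y : UpperVec m) :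
    ‖logStepDeriv g η α h y‖ ≤ ν⁻¹ + α * (Lg + η * ν⁻¹) := by
  refine (norm_sub_le _ _).trans (add_le_add (norm_diagOp_inv_le hν hνh) ?_)
  rw [norm_smul, Real.norm_of_nonneg hα]
  exact mul_le_mul_of_nonneg_left (S.norm_regHess_le hh hν hνh y) hα

lemma norm_logStepDeriv_sub_le {h x : LowerVec d} (hh : h ∈ simplexProd d)
    (hx : x ∈ simplexProd d) {ν : ℝ} (hν : 0 < ν) (hνh : ∀ p, ν ≤ h p) (hνx : ∀ p, ν ≤ x p)
    {α : ℝ} (hα : 0 ≤ α) (y : UpperVec m) :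
    ‖logStepDeriv g η α h y - logStepDeriv g η α x y‖ ≤
      (ν⁻¹ ^ 2 + α * (ρh + η * ν⁻¹ ^ 2)) * ‖h - x‖ := by
  have hη := S.eta_pos
  have h1 := norm_diagOp_inv_sub_le hν hνx hνh
  have h2 : ‖regHess g η h y - regHess g η x y‖ ≤
      ρh * ‖h - x‖ + η * (ν⁻¹ ^ 2 * ‖h - x‖) := by
    have e : regHess g η h y - regHess g η x y = (hessLower g h y - hessLower g x y) +
        η • (diagOp (fun p => (h p)⁻¹) - diagOp (fun p => (x p)⁻¹)) := by
      simp only [regHess]; module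
    rw [e]
    refine (norm_add_le _ _).trans (add_le_add (S.lipschitz_hess_lower y h hh x hx) ?_)
    rw [norm_smul, Real.norm_of_nonneg hη.le]
    exact mul_le_mul_of_nonneg_left h1 hη.le
  have e : logStepDeriv g η α h y - logStepDeriv g η α x y =
      (diagOp (fun p => (h p)⁻¹) - diagOp (fun p => (x p)⁻¹)) -
        α • (regHess g η h y - regHess g η x y) := by
    simp only [logStepDeriv]; module
  rw [e]
  refine (norm_sub_le _ _).trans ?_
  rw [norm_smul, Real.norm_of_nonneg hα]
  refine (add_le_add h1 (mul_le_mul_of_nonneg_left h2 hα)).trans_eq (by ring)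

/-! ### Convergence of iterative differentiation -/

/-- One step of iterative differentiation contracts the error `R - R^*`, measured in the norm
`v ↦ ‖v / √x‖` of the solution `x`, up to a perturbation proportional to the distances of the
current and the next iterate from `x`. -/
lemma exists_jacobianStep_error {α : ℝ} (hα : 0 ≤ α) (hα' : α * (4 * Lg + η) ≤ 1)
    (hαη : α * η < 1) : ∃ Q : ℝ, 0 ≤ Q ∧ ∀ (y : UpperVec m) (R₀ R : UpperVec m →L[ℝ] LowerVec d),
      IsImplicitDeriv g η y R₀ → (∀ w, R w ∈ tangent d) → ∀ h ∈ truncSimplexProd d η Ωg, ∀ e : ℝ,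
      ‖h - lowerSolution g η y‖ ≤ e → ‖mirrorStep g η α h y - lowerSolution g η y‖ ≤ e →
      ‖diagOp (fun p => (√(lowerSolution g η y p))⁻¹) ∘L (jacobianStep g η α R h y - R₀)‖ ≤
        (1 - α * η + Q * e) *
          ‖diagOp (fun p => (√(lowerSolution g η y p))⁻¹) ∘L (R - R₀)‖ + Q * e := by
  obtain ⟨ν, hν, hνt⟩ := exists_pos_le_of_mem_trunc d η Ωg
  have hη := S.eta_pos
  have hΛ := S.Λ_nonneg
  have hL := S.Lg_nonneg
  have hρ := S.ρh_nonneg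
  have hτ := S.τh_nonneg
  set n : ℝ := (Fintype.card (Σ i : Fin N, Fin (d i)) : ℝ)
  set c1 : ℝ := ν⁻¹ ^ 2 + α * (ρh + η * ν⁻¹ ^ 2)
  set c3 : ℝ := ν⁻¹ + α * (Lg + η * ν⁻¹)
  set s : ℝ := (√ν)⁻¹
  set ρ : ℝ := 1 + Λ / η
  refine ⟨s * (2 * n * (c1 * ρ + α * τh) + n * (2 + n) * (c3 * ρ + α * Λ)), by positivity,
    fun y R₀ R hR₀ hR h hh e he he' => ?_⟩
  have hxt := S.lowerSolution_mem_trunc y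
  have hxpos := S.lowerSolution_pos y
  have hfix := S.implicitDeriv_fixedPoint hR₀ α
  have hR₀n := S.norm_implicitDeriv_le hR₀
  set x := lowerSolution g η y with hx
  have hxm := truncSimplexProd_subset hxt
  have hhm := truncSimplexProd_subset hh
  have hhpos := pos_of_mem_trunc hh
  have hx'm := S.mirrorStep_mem hhpos α y
  have he0 : 0 ≤ e := (norm_nonneg _).trans he
  set x' := mirrorStep g η α h y with hx'
  set D := diagOp (fun p => (√(x p))⁻¹) with hD
  have hDn : ‖D‖ ≤ s := norm_diagOp_inv_sqrt_le hν (hνt x hxt)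
  set a := ‖D ∘L (R - R₀)‖ with ha
  have ha0 : 0 ≤ a := norm_nonneg _
  have hEn : ‖R - R₀‖ ≤ a := norm_le_norm_diagOp_inv_sqrt_comp hxm hxpos _
  have hRn : ‖R‖ ≤ ρ * (a + 1) := by
    have h1 : ‖R‖ ≤ ‖R - R₀‖ + ‖R₀‖ := by simpa using norm_add_le (R - R₀) R₀
    have h2 : 0 ≤ Λ / η * a := by positivity
    simp only [ρ]
    linarith
  -- the error splits into the contraction at `x`, the change of the coefficients of the
  -- linear recursion, and the change of the softmax Jacobian
  set W := logStepDeriv g η α h y ∘L R - α • crossDeriv g h y with hW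
  set Z := (logStepDeriv g η α h y - logStepDeriv g η α x y) ∘L R -
    α • (crossDeriv g h y - crossDeriv g x y) with hZ
  have hWn : ‖W‖ ≤ (c3 * ρ + α * Λ) * (a + 1) := by
    have h1 := S.norm_logStepDeriv_le hhm hν (hνt h hh) hα y
    have h2 := S.bounded_cross y h hhm
    calc ‖W‖ ≤ ‖logStepDeriv g η α h y ∘L R‖ + ‖α • crossDeriv g h y‖ := norm_sub_le _ _
      _ ≤ c3 * (ρ * (a + 1)) + α * Λ := by
          refine add_le_add ((ContinuousLinearMap.opNorm_comp_le _ _).trans (by gcongr)) ?_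
          rw [norm_smul, Real.norm_of_nonneg hα]
          gcongr
      _ ≤ _ := by
          have : 0 ≤ α * Λ * a := by positivity
          linarith
  have hZn : ‖Z‖ ≤ (c1 * ρ + α * τh) * (a + 1) * e := by
    have h1 := S.norm_logStepDeriv_sub_le hhm hxm hν (hνt h hh) (hνt x hxt) hα y
    have h2 := S.lipschitz_cross_lower y h hhm x hxm
    calc ‖Z‖ ≤ ‖(logStepDeriv g η α h y - logStepDeriv g η α x y) ∘L R‖ +
          ‖α • (crossDeriv g h y - crossDeriv g x y)‖ := norm_sub_le _ _
      _ ≤ c1 * e * (ρ * (a + 1)) + α * (τh * e) := by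
          refine add_le_add ((ContinuousLinearMap.opNorm_comp_le _ _).trans ?_) ?_
          · exact mul_le_mul (h1.trans (by gcongr)) hRn (norm_nonneg _) (by positivity)
          · rw [norm_smul, Real.norm_of_nonneg hα]
            exact mul_le_mul_of_nonneg_left (h2.trans (by gcongr)) hα
      _ ≤ _ := by
          have : 0 ≤ α * τh * a * e := by positivity
          linarith
  have hsplit : jacobianStep g η α R h y - R₀ =
      softmaxJac x ∘L logStepDeriv g η α x y ∘L (R - R₀) + softmaxJac x ∘L Z +
        (softmaxJac x' - softmaxJac x) ∘L W := by
    conv_lhs => rw [S.jacobianStep_eq hhm hhpos, ← hfix]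
    ext1 w
    simp only [hW, hZ, ContinuousLinearMap.comp_apply, _root_.sub_apply, _root_.add_apply,
      _root_.smul_apply, map_sub, map_smul, smul_sub]
    abel
  have hT1 : ‖D ∘L (softmaxJac x ∘L logStepDeriv g η α x y ∘L (R - R₀))‖ ≤ (1 - α * η) * a := by
    refine ContinuousLinearMap.opNorm_le_bound _ (mul_nonneg (by linarith) ha0) fun w => ?_
    have h1 := S.norm_softmaxJac_logStepDeriv_le hxm hxpos hα hα' hαη y
      ((tangent d).sub_mem (hR w) (hR₀.1 w))
    refine h1.trans ?_
    rw [mul_assoc]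
    exact mul_le_mul_of_nonneg_left (ContinuousLinearMap.le_opNorm (D ∘L (R - R₀)) w)
      (by linarith)
  have hT2 : ‖D ∘L (softmaxJac x ∘L Z)‖ ≤ s * (2 * n * ((c1 * ρ + α * τh) * (a + 1) * e)) := by
    refine (ContinuousLinearMap.opNorm_comp_le _ _).trans
      (mul_le_mul hDn ?_ (norm_nonneg _) (by positivity))
    exact (ContinuousLinearMap.opNorm_comp_le _ _).trans
      (mul_le_mul (norm_softmaxJac_le hxm) hZn (norm_nonneg _) (by positivity))
  have hT3 : ‖D ∘L ((softmaxJac x' - softmaxJac x) ∘L W)‖ ≤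
      s * (n * (2 + n) * e * ((c3 * ρ + α * Λ) * (a + 1))) := by
    refine (ContinuousLinearMap.opNorm_comp_le _ _).trans
      (mul_le_mul hDn ?_ (norm_nonneg _) (by positivity))
    refine (ContinuousLinearMap.opNorm_comp_le _ _).trans
      (mul_le_mul ?_ hWn (norm_nonneg _) (by positivity))
    exact (norm_softmaxJac_sub_le hx'm hxm).trans (by gcongr)
  rw [hsplit, ContinuousLinearMap.comp_add, ContinuousLinearMap.comp_add]
  refine (norm_add₃_le.trans (add_le_add (add_le_add hT1 hT2) hT3)).trans_eq ?_
  ring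

/-- The lower-level iterates and their Jacobians converge linearly to the solution and its
derivative, uniformly in the starting point and in `y`. -/
lemma exists_linear_convergence {α : ℝ} (hα : 0 < α) (hα' : α * (4 * Lg + η) ≤ 1)
    (hαη : α * η < 1) : ∃ lam M : ℝ, 0 < lam ∧ lam < 1 ∧ 0 ≤ M ∧
      ∀ (y : UpperVec m) (R₀ : UpperVec m →L[ℝ] LowerVec d), IsImplicitDeriv g η y R₀ →
      ∀ h ∈ truncSimplexProd d η Ωg, ∀ t,
        ‖lowerIter g η α h y t - lowerSolution g η y‖ ≤ M * lam ^ t ∧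
        ‖jacobianIter g η α h y t - R₀‖ ≤ M * lam ^ t := by
  obtain ⟨ν, hν, hνt⟩ := exists_pos_le_of_mem_trunc d η Ωg
  have hη := S.eta_pos
  have hΛ := S.Λ_nonneg
  obtain ⟨Q, hQ, hstep⟩ := S.exists_jacobianStep_error hα.le hα' hαη
  set c : ℝ := √(4 * ((Fintype.card (Σ i : Fin N, Fin (d i)) : ℝ) / ν))
  set q : ℝ := √(1 - α * η) with hqdef
  have hq1 : q < 1 := by
    rw [hqdef, Real.sqrt_lt' one_pos]
    have := mul_pos hα hη
    linarith
  have hq0 : 0 ≤ q := Real.sqrt_nonneg _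
  have hc0 : 0 ≤ c := Real.sqrt_nonneg _
  have hr1 : 1 - α * η < 1 := by
    have := mul_pos hα hη
    linarith
  obtain ⟨lam, M, hl0, hl1, hql, hM0, hM⟩ := exists_geometric_bound (r := 1 - α * η) (q := q)
    (Q := Q * c) (a₀ := (√ν)⁻¹ * (Λ / η)) (by linarith) hr1 hq0 hq1 (by positivity)
    (by positivity)
  refine ⟨lam, max M c, hl0, hl1, le_max_of_le_left hM0, fun y R₀ hR₀ h hh t => ?_⟩
  have hconv := S.norm_lowerIter_sub_le hν hνt hh (S.isLowerSolution_lowerSolution y) hα.le hα'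
  have hmem := S.lowerIter_mem_trunc hh hα.le hα' y
  have hxt := S.lowerSolution_mem_trunc y
  constructor
  · refine (hconv t).trans (mul_le_mul (le_max_right _ _) (pow_le_pow_left₀ hq0 hql t)
      (by positivity) (le_max_of_le_left hM0))
  have htan : ∀ t w, jacobianIter g η α h y t w ∈ tangent d := fun t w => by
    cases t with
    | zero => exact (tangent d).zero_mem
    | succ t =>
      exact S.jacobianStep_mem_tangent (truncSimplexProd_subset (hmem t))
        (pos_of_mem_trunc (hmem t)) α y _ w
  set D := diagOp (fun p => (√(lowerSolution g η y p))⁻¹) with hD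
  have hDn : ‖D‖ ≤ (√ν)⁻¹ := norm_diagOp_inv_sqrt_le hν (hνt _ hxt)
  have hbound := hM (fun t => ‖D ∘L (jacobianIter g η α h y t - R₀)‖)
    (by
      refine (ContinuousLinearMap.opNorm_comp_le _ _).trans
        (mul_le_mul hDn ?_ (norm_nonneg _) (by positivity))
      rw [jacobianIter, zero_sub, norm_neg]
      exact S.norm_implicitDeriv_le hR₀)
    (fun t => by
      have h1 : ‖lowerIter g η α h y (t + 1) - lowerSolution g η y‖ ≤ c * q ^ t :=
        (hconv (t + 1)).trans
          (mul_le_mul_of_nonneg_left (pow_le_pow_of_le_one hq0 hq1.le (Nat.le_succ t)) hc0)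
      have h2 := hstep y R₀ (jacobianIter g η α h y t) hR₀ (htan t) _ (hmem t) (c * q ^ t)
        (hconv t) h1
      rw [mul_assoc Q c]
      exact h2) t
  have hEn : ‖jacobianIter g η α h y t - R₀‖ ≤ ‖D ∘L (jacobianIter g η α h y t - R₀)‖ :=
    norm_le_norm_diagOp_inv_sqrt_comp (S.lowerSolution_mem y) (S.lowerSolution_pos y) _
  exact (hEn.trans hbound).trans (by gcongr; exact le_max_left _ _)

end RegularLower

end

section

variable {N : ℕ} {d : Fin N → ℕ} {m : ℕ}
variable {f g : LowerVec d → UpperVec m → ℝ} {η Lf Ωf Lg Ωg τh ρh Λ τy ρy : ℝ}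

/-! ### Convergence of the algorithm -/

namespace RegularLower

variable (S : RegularLower g η Lg Ωg τh ρh Λ τy ρy)
include S

/-- The gradient estimator converges linearly to the gradient of the bilevel objective, uniformly
in the starting point and in `y`. -/
lemma exists_gradEstimate_error (hf : UpperAssumptions f Lf Ωf) (hLf : 0 ≤ Lf) (hΩf : 0 ≤ Ωf)
    {α : ℝ} (hα : 0 < α) (hα' : α * (4 * Lg + η) ≤ 1) (hαη : α * η < 1) :
    ∃ lam C : ℝ, 0 < lam ∧ lam < 1 ∧ ∀ (y : UpperVec m), ∀ h ∈ truncSimplexProd d η Ωg, ∀ D,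
      ‖gradEstimate f g η α D h y - gradient (bilevelObj f g η) y‖ ≤ C * lam ^ D := by
  obtain ⟨lam, M, hl0, hl1, hM0, hconv⟩ := S.exists_linear_convergence hα hα' hαη
  have hη := S.eta_pos
  have hΛ := S.Λ_nonneg
  refine ⟨lam, (1 + Λ / η) * (Lf * M) + M * Ωf, hl0, hl1, fun y h hh D => ?_⟩
  obtain ⟨R, hR⟩ := S.exists_isImplicitDeriv y
  obtain ⟨h1, h2⟩ := hconv y R hR h hh D
  rw [(S.hasGradientAt_bilevelObj hf hR).gradient]
  have h3 := norm_hypergradient_sub_le hf hLf (S.lowerSolution_mem y)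
    (truncSimplexProd_subset (S.lowerIter_mem_trunc hh hα.le hα' y D)) y y R
    (jacobianIter g η α h y D)
  rw [sub_self, norm_zero, add_zero] at h3
  have h4 := S.norm_implicitDeriv_le hR
  refine h3.trans ?_
  calc _ ≤ (1 + Λ / η) * (Lf * (M * lam ^ D)) + M * lam ^ D * Ωf := by gcongr
    _ = _ := by ring

lemma algorithm_fst_mem_trunc {α : ℝ} (hα : 0 ≤ α) (hα' : α * (4 * Lg + η) ≤ 1) (β : ℝ) (D : ℕ)
    {h0 : LowerVec d} (hh0 : h0 ∈ truncSimplexProd d η Ωg) (y0 : UpperVec m) (k : ℕ) :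
    (algorithm f g η α β D h0 y0 k).1 ∈ truncSimplexProd d η Ωg := by
  induction k with
  | zero => exact hh0
  | succ k ih => exact S.lowerIter_mem_trunc ih hα hα' _ D

end RegularLower

end

end Bilevel

end

theorem theorem1 {N m : ℕ} (d : Fin N → ℕ) (hd : ∀ i, 0 < d i)
    (f g : Bilevel.LowerVec d → Bilevel.UpperVec m → ℝ)
    (Lf Ωf Lg Ωg τh ρh Λ τy ρy : ℝ)
    (hf : Bilevel.UpperAssumptions f Lf Ωf)
    (hg : Bilevel.LowerAssumptions g Lg Ωg τh ρh Λ τy ρy)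
    (η : ℝ) (hη : 0 < η)
    (hF : BddBelow (Set.range (Bilevel.bilevelObj f g η))) :
    (∀ (y : Bilevel.UpperVec m) (h : Bilevel.LowerVec d),
        Bilevel.IsLowerSolution g η y h ↔ h = Bilevel.lowerSolution g η y) ∧
    Differentiable ℝ (Bilevel.bilevelObj f g η) ∧
    ∃ αmax βmin βmax : ℝ, 0 < αmax ∧ 0 < βmin ∧ βmin < βmax ∧
      ∀ α : ℝ, 0 < α → α ≤ αmax →
        ∃ (D0 : ℕ) (lam : ℝ), 0 < lam ∧ lam < 1 ∧
          ∃ C₂ : ℝ, ∀ y0 : Bilevel.UpperVec m, ∃ C₁ : ℝ,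
            ∀ β : ℝ, βmin ≤ β → β ≤ βmax → ∀ D : ℕ, D0 ≤ D →
              ∀ h0 ∈ Bilevel.truncSimplexProd d η Ωg, ∀ K : ℕ, 1 ≤ K →
                (1 / (K : ℝ)) * ∑ k ∈ Finset.range K,
                    ‖gradient (Bilevel.bilevelObj f g η)
                      (Bilevel.upperIter f g η α β D h0 y0 k)‖ ^ 2
                  ≤ C₁ / (K : ℝ) + C₂ * lam ^ D := by
  have S := hg.regularLower hd hη
  -- the product of simplices is nonempty, so the bound on the gradient of `f` is nonnegative
  obtain ⟨h₁, hh₁⟩ := Bilevel.simplexProd_nonempty hd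
  have hΩf : 0 ≤ Ωf := (norm_nonneg _).trans (hf.bounded_grad h₁ hh₁ 0)
  have hf' : Bilevel.UpperAssumptions f |Lf| Ωf :=
    { differentiable := hf.differentiable
      lipschitz_grad := fun h hh h' hh' y y' => (hf.lipschitz_grad h hh h' hh' y y').trans
        (mul_le_mul_of_nonneg_right (le_abs_self _) (norm_nonneg _))
      bounded_grad := hf.bounded_grad }
  have hdiff := S.differentiable_bilevelObj hf'
  obtain ⟨L, hL, hlip⟩ := S.exists_lipschitz_gradient_bilevelObj hf' (abs_nonneg _) hΩf
  obtain ⟨b, hb⟩ := hF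
  have hLg := S.Lg_nonneg
  refine ⟨S.isLowerSolution_iff, hdiff, 1 / (2 * (4 * |Lg| + η)), 1 / (4 * L), 1 / (2 * L),
    by positivity, by positivity, ?_, fun α hα hαm => ?_⟩
  · exact one_div_lt_one_div_of_lt (by positivity) (by linarith)
  have hα2 : α * (4 * |Lg| + η) ≤ 1 / 2 := by
    calc α * (4 * |Lg| + η) ≤ 1 / (2 * (4 * |Lg| + η)) * (4 * |Lg| + η) := by gcongr
      _ = 1 / 2 := by field_simp
  have hα' : α * (4 * |Lg| + η) ≤ 1 := by linarith
  have hαη : α * η < 1 := by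
    have := mul_nonneg hα.le hLg
    linarith
  obtain ⟨lam, C, hl0, hl1, herr⟩ :=
    S.exists_gradEstimate_error hf' (abs_nonneg _) hΩf hα hα' hαη
  refine ⟨0, lam, hl0, hl1, C ^ 2, fun y0 =>
    ⟨2 * (Bilevel.bilevelObj f g η y0 - b) / (1 / (4 * L)), fun β hβ hβ' D _ h0 hh0 K hK => ?_⟩⟩
  refine (Bilevel.average_norm_gradient_sq_le hdiff hL hlip
    (fun y => hb ⟨y, rfl⟩) (by positivity) hβ hβ'
    (y := Bilevel.upperIter f g η α β D h0 y0) (e := C * lam ^ D) (fun k => rfl)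
    (fun k => herr _ _ (S.algorithm_fst_mem_trunc hα.le hα' β D hh0 y0 k) D) hK).trans ?_
  refine add_le_add le_rfl ?_
  rw [mul_pow]
  gcongr
  exact pow_le_of_le_one (by positivity) (pow_le_one₀ hl0.le hl1.le) two_ne_zero
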